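/- Let $k$ be an algebraically closed field of characteristic $0$. A fusion category over $k$ is a $k$-linear semisimple rigid tensor category with finitely many simple objects up to isomorphism, finite-dimensional $\operatorname{Hom}$ spaces and simple unit object; it is pointed if all its simple objects are invertible. A fusion subcategory is a full replete subcategory that contains the unit object and is closed under tensor products, finite direct sums, direct summands and duals; it is proper if it is not the whole category. Let $\mathcal I$ be an Ising category over $k$, that is, a fusion category of Frobenius--Perron dimension $4$ which is not pointed (for instance the semisimplification of the representation category of $U_{-q}(\mathfrak{sl}_2)$ with $q=\exp(i\pi/4)$, when $k=\mathbb C$), and let $Z$ be its non-invertible simple object, which is unique up to isomorphism. Let $N\ge 1$, let $\zeta\in k^\times$ with $\zeta^{2^N}=1$, and let $\omega_\zeta$ be the $3$-cocycle on $\mathbb Z/2^N$ with $\omega_\zeta(i,j,\ell)=1$ if $j+\ell<2^N$ and $\omega_\zeta(i,j,\ell)=\zeta^{i}$ if $j+\ell\ge 2^N$, for $0\le i,j,\ell<2^N$. Let $\mathcal I_{N,\zeta}$ be the fusion subcategory of $\mathcal I\boxtimes \mathrm{Vec}_{\mathbb Z/2^N}^{\omega_\zeta}$ generated by the simple object $Z\boxtimes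 1$, where $1$ is the generator of $\mathbb Z/2^N$. Then every proper fusion subcategory of $\mathcal I_{N,\zeta}$ is pointed. In particular, $\mathcal I_{N,\zeta}$ admits no proper exact factorization: there are no proper fusion subcategories $\mathcal A$, $\mathcal B$ of $\mathcal I_{N,\zeta}$ such that every object of $\mathcal I_{N,\zeta}$ is a direct summand of $X\otimes Y$ for some $X\in\mathcal A$, $Y\in\mathcal B$, and such that the unit object is, up to isomorphism, the only simple object in $\mathcal A\cap\mathcal B$. -/

import Mathlib

open CategoryTheory CategoryTheory.Limits CategoryTheory.MonoidalCategory

universe u v w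

noncomputable section

namespace NIsing

section Cocycle

/-- A normalized 3-cocycle on the (additively written) group `G` with values in `kˣ`,
with trivial action. (Its value is `1` as soon as one argument is `0`; for the outer arguments this
follows from the two axioms.) -/
structure Cocycle3 (G : Type) [AddGroup G] (k : Type w) [Field k] where
  /-- the underlying function -/
  toFun : G → G → G → kˣ
  cocycle : ∀ a b c d, toFun b c d * toFun a (b + c) d * toFun a b c =
    toFun (a + b) c d * toFun a b (c + d)
  map_zero_mid : ∀ a b, toFun a 0 b = 1

/-- The 3-cocycle `ω_ζ` on `ℤ/M` attached to an `M`-th root of unity `ζ`: for representatives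
`0 ≤ i, j, l < M`, its value at `(i, j, l)` is `1` if `j + l < M` and `ζ ^ i` otherwise. -/
def omega {k : Type w} [Field k] (M : ℕ) [NeZero M] (ζ : rootsOfUnity M k) :
    Cocycle3 (ZMod M) k where
  toFun i j l := if j.val + l.val < M then 1 else (ζ : kˣ) ^ i.val
  cocycle a b c d := by
    have hζ : (ζ : kˣ) ^ M = 1 := (mem_rootsOfUnity M _).1 ζ.2
    have ha := ZMod.val_lt a
    have hb := ZMod.val_lt b
    have hc := ZMod.val_lt c
    have hd := ZMod.val_lt d
    have key : ∀ x y : ZMod M, (ζ : kˣ) ^ (x + y).val = (ζ : kˣ) ^ x.val * (ζ : kˣ) ^ y.val := by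
      intro x y
      rw [ZMod.val_add, ← pow_add]
      conv_rhs => rw [← Nat.mod_add_div (x.val + y.val) M]
      rw [pow_add, pow_mul, hζ, one_pow, mul_one]
    have hadd : ∀ x y : ZMod M, (x + y).val = if x.val + y.val < M then x.val + y.val
        else x.val + y.val - M := by
      intro x y
      split_ifs with h
      · exact ZMod.val_add_of_lt h
      · have := ZMod.val_add_val_of_le (not_lt.1 h)
        omega
    rw [key, hadd b c, hadd c d]
    by_cases h1 : b.val + c.val < M <;> by_cases h2 : c.val + d.val < M <;>
      simp only [h1, h2, if_true, if_false, one_mul, mul_one]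
    · by_cases h3 : b.val + c.val + d.val < M
      · have : b.val + (c.val + d.val) < M := by omega
        simp [h3, this]
      · have : ¬ b.val + (c.val + d.val) < M := by omega
        simp [h3, this]
    · have h3 : ¬ b.val + c.val + d.val < M := by omega
      have h4 : b.val + (c.val + d.val - M) < M := by omega
      simp [h3, h4, mul_comm]
    · have h3 : b.val + c.val - M + d.val < M := by omega
      have h4 : ¬ b.val + (c.val + d.val) < M := by omega
      simp [h3, h4]
    · by_cases h3 : b.val + c.val - M + d.val < M
      · have : b.val + (c.val + d.val - M) < M := by omega
        simp [h3, this, mul_comm]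
      · have : ¬ b.val + (c.val + d.val - M) < M := by omega
        simp [h3, this, mul_comm]
  map_zero_mid a b := by
    simp [ZMod.val_lt b]

end Cocycle

section General

variable {C : Type u} [Category.{v} C] [MonoidalCategory C]

/-- `X` is invertible for the tensor product. -/
def IsInvertible (X : C) : Prop :=
  ∃ Y : C, Nonempty (X ⊗ Y ≅ 𝟙_ C) ∧ Nonempty (Y ⊗ X ≅ 𝟙_ C)

variable (C) in
/-- A pointed category: every simple object is invertible. -/
def IsPointed [HasZeroMorphisms C] : Prop :=
  ∀ X : C, Simple X → IsInvertible X

/-- A fusion subcategory, given by the class `P` of its objects: a full replete subcategory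
containing the unit object and closed under tensor products, finite direct sums, direct summands,
and left and right duals. (The zero object is a direct summand of the unit object.) -/
class IsFusionSubcategory [HasZeroMorphisms C] (P : ObjectProperty C) : Prop
    extends P.IsMonoidal where
  of_retract : ∀ {X Y : C}, Retract X Y → P Y → P X
  of_isBilimit : ∀ {X Y : C} (b : BinaryBicone X Y), b.IsBilimit → P X → P Y → P b.pt
  right_dual : ∀ {X Y : C}, ExactPairing X Y → P X → P Y
  left_dual : ∀ {X Y : C}, ExactPairing X Y → P Y → P X

/-- The fusion subcategory generated by an object: the smallest one that contains it. -/
def fusionClosure [HasZeroMorphisms C] (S : C) : ObjectProperty C :=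
  fun X => ∀ P : ObjectProperty C, IsFusionSubcategory P → P S → P X

instance [HasZeroMorphisms C] (S : C) : IsFusionSubcategory (fusionClosure S) where
  prop_unit := fun _ hP _ => hP.prop_unit
  prop_tensor := fun _ _ h₁ h₂ P hP hS => hP.prop_tensor _ _ (h₁ P hP hS) (h₂ P hP hS)
  of_retract := fun r h P hP hS => hP.of_retract r (h P hP hS)
  of_isBilimit := fun b hb h₁ h₂ P hP hS => hP.of_isBilimit b hb (h₁ P hP hS) (h₂ P hP hS)
  right_dual := fun e h P hP hS => hP.right_dual e (h P hP hS)
  left_dual := fun e h P hP hS => hP.left_dual e (h P hP hS)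

lemma self_fusionClosure [HasZeroMorphisms C] (S : C) : fusionClosure S S :=
  fun _ _ h => h

/-- `C = A • B` is an exact factorization into the fusion subcategories `A` and `B`:
every object of `C` is a direct summand of `X ⊗ Y` for some `X` in `A` and `Y` in `B`, and
`A ∩ B` is the trivial fusion subcategory (its only simple object is the unit object). -/
structure IsExactFactorization [HasZeroMorphisms C] (A B : ObjectProperty C) : Prop where
  left : IsFusionSubcategory A
  right : IsFusionSubcategory B
  factor : ∀ W : C, ∃ X Y : C, A X ∧ B Y ∧ Nonempty (Retract W (X ⊗ Y))
  inter : ∀ X : C, Simple X → A X → B X → Nonempty (X ≅ 𝟙_ C)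

end General

section Fusion

attribute [local instance] Abelian.hasFiniteBiproducts

/-- `S` lists every simple object of `C` exactly once up to isomorphism. -/
structure IsCompleteSimples {C : Type u} [Category.{v} C] [HasZeroMorphisms C] {n : ℕ}
    (S : Fin n → C) : Prop where
  simple : ∀ i, Simple (S i)
  eq_of_iso : ∀ i j, Nonempty (S i ≅ S j) → i = j
  exists_iso : ∀ X : C, Simple X → ∃ i, Nonempty (X ≅ S i)

/-- A fusion category over `k`: a `k`-linear semisimple rigid tensor category with finitely many
isomorphism classes of simple objects, finite-dimensional spaces of morphisms, and simple unit
object. -/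
structure IsFusionCategory (k : Type w) [Field k] (C : Type u) [Category.{v} C] [Abelian C]
    [Linear k C] [MonoidalCategory C] [MonoidalPreadditive C] [MonoidalLinear k C]
    [RigidCategory C] : Prop where
  semisimple : ∀ X : C, ∃ (n : ℕ) (S : Fin n → C), (∀ i, Simple (S i)) ∧ Nonempty (X ≅ ⨁ S)
  finite_simples : ∃ (n : ℕ) (S : Fin n → C), IsCompleteSimples S
  finite_hom : ∀ X Y : C, FiniteDimensional k (X ⟶ Y)
  simple_unit : Simple (𝟙_ C)

/-- `d` is the Frobenius-Perron dimension of objects: the unique unital ring homomorphism from the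
Grothendieck ring to `ℝ` with value at least `1` on all nonzero objects. -/
structure IsFPdim {C : Type u} [Category.{v} C] [Abelian C] [MonoidalCategory C]
    (d : C → ℝ) : Prop where
  iso : ∀ X Y : C, Nonempty (X ≅ Y) → d X = d Y
  biprod : ∀ X Y : C, d (X ⊞ Y) = d X + d Y
  tensor : ∀ X Y : C, d (X ⊗ Y) = d X * d Y
  unit : d (𝟙_ C) = 1
  one_le : ∀ X : C, ¬ IsZero X → 1 ≤ d X

/-- The Frobenius-Perron dimension of the category `C`, i.e. the sum of the squares of the
Frobenius-Perron dimensions of its simple objects up to isomorphism, is `D`. -/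
def HasFPdim (C : Type u) [Category.{v} C] [Abelian C] [MonoidalCategory C] (D : ℝ) : Prop :=
  ∃ d : C → ℝ, IsFPdim d ∧
    ∃ (n : ℕ) (S : Fin n → C), IsCompleteSimples S ∧ ∑ i, d (S i) ^ 2 = D

/-- An Ising category over `k`: a fusion category of Frobenius-Perron dimension `4` which is not
pointed. -/
structure IsIsingCategory (k : Type w) [Field k] (C : Type u) [Category.{v} C] [Abelian C]
    [Linear k C] [MonoidalCategory C] [MonoidalPreadditive C] [MonoidalLinear k C]
    [RigidCategory C] : Prop extends IsFusionCategory k C where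
  fpdim : HasFPdim C 4
  not_pointed : ¬ IsPointed C

end Fusion

section Twist

open GradedObject

attribute [local instance] Abelian.hasFiniteBiproducts

variable {I : Type u} [Category.{v} I] [Abelian I] [MonoidalCategory I] [MonoidalPreadditive I]
  {G : Type} [AddGroup G] [Finite G]

instance preservesFiniteCoproducts_left (X : I) :
    PreservesFiniteCoproducts ((curriedTensor I).obj X) :=
  inferInstanceAs (PreservesFiniteCoproducts (tensorLeft X))

instance preservesFiniteCoproducts_right (X : I) :
    PreservesFiniteCoproducts ((curriedTensor I).flip.obj X) :=
  inferInstanceAs (PreservesFiniteCoproducts (tensorRight X))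

instance hasTensor (X₁ X₂ : GradedObject G I) : HasTensor X₁ X₂ := fun _ => inferInstance

instance hasGoodTensor₁₂Tensor (X₁ X₂ X₃ : GradedObject G I) :
    HasGoodTensor₁₂Tensor X₁ X₂ X₃ := fun _ _ => inferInstance

instance hasGoodTensorTensor₂₃ (X₁ X₂ X₃ : GradedObject G I) :
    HasGoodTensorTensor₂₃ X₁ X₂ X₃ := fun _ _ => inferInstance

instance hasTensor₄ObjExt (X₁ X₂ X₃ X₄ : GradedObject G I) :
    HasTensor₄ObjExt X₁ X₂ X₃ X₄ := fun _ _ => inferInstance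

variable {k : Type w} [Field k] [Linear k I] [MonoidalLinear k I]

/-- The endomorphism of `X ⊗ (Y ⊗ Z)` in `G`-graded objects that multiplies the summand
`X a ⊗ (Y b ⊗ Z c)` by the scalar `f a b c`. -/
def twistHom (f : G → G → G → kˣ) (X Y Z : GradedObject G I) :
    Monoidal.tensorObj X (Monoidal.tensorObj Y Z) ⟶
      Monoidal.tensorObj X (Monoidal.tensorObj Y Z) :=
  fun j => Monoidal.tensorObjDesc fun a bc h =>
    (X a ◁ Monoidal.tensorObjDesc fun b c h' =>
      ((f a b c : kˣ) : k) • Monoidal.ιTensorObj Y Z b c bc h') ≫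
      Monoidal.ιTensorObj X (Monoidal.tensorObj Y Z) a bc j h

@[simp]
lemma ι_twistHom (f : G → G → G → kˣ) (X Y Z : GradedObject G I) (a b c j : G)
    (h : a + b + c = j) :
    Monoidal.ιTensorObj₃ X Y Z a b c j h ≫ twistHom f X Y Z j =
      ((f a b c : kˣ) : k) • Monoidal.ιTensorObj₃ X Y Z a b c j h := by
  simp only [Monoidal.ιTensorObj₃, twistHom, Category.assoc, Monoidal.ι_tensorObjDesc]
  rw [← MonoidalCategory.whiskerLeft_comp_assoc, Monoidal.ι_tensorObjDesc,
    MonoidalLinear.whiskerLeft_smul, Linear.smul_comp]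

@[simp]
lemma ι_twistHom_assoc (f : G → G → G → kˣ) (X Y Z : GradedObject G I) (a b c j : G)
    (h : a + b + c = j) {W : I} (g : Monoidal.tensorObj X (Monoidal.tensorObj Y Z) j ⟶ W) :
    Monoidal.ιTensorObj₃ X Y Z a b c j h ≫ twistHom f X Y Z j ≫ g =
      ((f a b c : kˣ) : k) • (Monoidal.ιTensorObj₃ X Y Z a b c j h ≫ g) := by
  rw [← Category.assoc, ι_twistHom, Linear.smul_comp]

/-- `twistHom` as an isomorphism. -/
def twistIso (f : G → G → G → kˣ) (X Y Z : GradedObject G I) :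
    Monoidal.tensorObj X (Monoidal.tensorObj Y Z) ≅
      Monoidal.tensorObj X (Monoidal.tensorObj Y Z) where
  hom := twistHom f X Y Z
  inv := twistHom (fun a b c => (f a b c)⁻¹) X Y Z
  hom_inv_id := by
    ext j a b c h
    simp [smul_smul]
  inv_hom_id := by
    ext j a b c h
    simp [smul_smul]

/-- The associator of `G`-graded objects twisted by the scalars `f a b c`: on the summand
`(X a ⊗ Y b) ⊗ Z c` it is `f a b c` times the associator of `I`. -/
def twistAssociator (f : G → G → G → kˣ) (X Y Z : GradedObject G I) :
    Monoidal.tensorObj (Monoidal.tensorObj X Y) Z ≅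
      Monoidal.tensorObj X (Monoidal.tensorObj Y Z) :=
  Monoidal.associator X Y Z ≪≫ twistIso f X Y Z

@[simp]
lemma ι_twistAssociator_hom (f : G → G → G → kˣ) (X Y Z : GradedObject G I) (a b c j : G)
    (h : a + b + c = j) :
    Monoidal.ιTensorObj₃' X Y Z a b c j h ≫ (twistAssociator f X Y Z).hom j =
      ((f a b c : kˣ) : k) • ((α_ (X a) (Y b) (Z c)).hom ≫ Monoidal.ιTensorObj₃ X Y Z a b c j h) := by
  simp [twistAssociator, twistIso]

@[simp]
lemma ι_twistAssociator_inv (f : G → G → G → kˣ) (X Y Z : GradedObject G I) (a b c j : G)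
    (h : a + b + c = j) :
    Monoidal.ιTensorObj₃ X Y Z a b c j h ≫ (twistAssociator f X Y Z).inv j =
      (((f a b c)⁻¹ : kˣ) : k) •
        ((α_ (X a) (Y b) (Z c)).inv ≫ Monoidal.ιTensorObj₃' X Y Z a b c j h) := by
  simp [twistAssociator, twistIso]

@[simp]
lemma ι_twistAssociator_hom_assoc (f : G → G → G → kˣ) (X Y Z : GradedObject G I) (a b c j : G)
    (h : a + b + c = j) {W : I} (g : Monoidal.tensorObj X (Monoidal.tensorObj Y Z) j ⟶ W) :
    Monoidal.ιTensorObj₃' X Y Z a b c j h ≫ (twistAssociator f X Y Z).hom j ≫ g =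
      (((f a b c : kˣ) : k) •
        ((α_ (X a) (Y b) (Z c)).hom ≫ Monoidal.ιTensorObj₃ X Y Z a b c j h)) ≫ g := by
  rw [← Category.assoc, ι_twistAssociator_hom]

@[simp]
lemma ι_twistAssociator_inv_assoc (f : G → G → G → kˣ) (X Y Z : GradedObject G I) (a b c j : G)
    (h : a + b + c = j) {W : I}
    (g : Monoidal.tensorObj (Monoidal.tensorObj X Y) Z j ⟶ W) :
    Monoidal.ιTensorObj₃ X Y Z a b c j h ≫ (twistAssociator f X Y Z).inv j ≫ g =
      ((((f a b c)⁻¹ : kˣ) : k) •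
        ((α_ (X a) (Y b) (Z c)).inv ≫ Monoidal.ιTensorObj₃' X Y Z a b c j h)) ≫ g := by
  rw [← Category.assoc, ι_twistAssociator_inv]

lemma twistAssociator_naturality (f : G → G → G → kˣ) {X₁ X₂ X₃ Y₁ Y₂ Y₃ : GradedObject G I}
    (f₁ : X₁ ⟶ Y₁) (f₂ : X₂ ⟶ Y₂) (f₃ : X₃ ⟶ Y₃) :
    Monoidal.tensorHom (Monoidal.tensorHom f₁ f₂) f₃ ≫ (twistAssociator f Y₁ Y₂ Y₃).hom =
      (twistAssociator f X₁ X₂ X₃).hom ≫ Monoidal.tensorHom f₁ (Monoidal.tensorHom f₂ f₃) := by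
  ext j a b c h
  simp

lemma twist_pentagon_inv (ω : Cocycle3 G k) (X₁ X₂ X₃ X₄ : GradedObject G I) :
    Monoidal.tensorHom (𝟙 X₁) (twistAssociator ω.toFun X₂ X₃ X₄).inv ≫
        (twistAssociator ω.toFun X₁ (Monoidal.tensorObj X₂ X₃) X₄).inv ≫
        Monoidal.tensorHom (twistAssociator ω.toFun X₁ X₂ X₃).inv (𝟙 X₄) =
    (twistAssociator ω.toFun X₁ X₂ (Monoidal.tensorObj X₃ X₄)).inv ≫
      (twistAssociator ω.toFun (Monoidal.tensorObj X₁ X₂) X₃ X₄).inv := by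
  ext j i₁ i₂ i₃ i₄ h
  dsimp only [categoryOfGradedObjects_comp]
  conv_lhs =>
    rw [Monoidal.ιTensorObj₄_eq X₁ X₂ X₃ X₄ i₁ i₂ i₃ i₄ j h _ rfl, Category.assoc,
      Monoidal.ι_tensorHom_assoc]
    dsimp only [categoryOfGradedObjects_id]
    rw [id_tensorHom, ← MonoidalCategory.whiskerLeft_comp_assoc, ι_twistAssociator_inv,
      Monoidal.ιTensorObj₃'_eq X₂ X₃ X₄ i₂ i₃ i₄ _ rfl _ rfl, MonoidalLinear.whiskerLeft_smul,
      Linear.smul_comp, MonoidalCategory.whiskerLeft_comp_assoc,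
      MonoidalCategory.whiskerLeft_comp_assoc,
      ← Monoidal.ιTensorObj₃_eq_assoc X₁ (Monoidal.tensorObj X₂ X₃) X₄ i₁ (i₂ + i₃) i₄ j
        (by simp only [← add_assoc, h]) _ rfl, ι_twistAssociator_inv_assoc,
      Linear.smul_comp, Linear.comp_smul, Linear.comp_smul, Category.assoc,
      Monoidal.ιTensorObj₃'_eq_assoc X₁ (Monoidal.tensorObj X₂ X₃) X₄ i₁ (i₂ + i₃) i₄ j
        (by simp only [← add_assoc, h]) (i₁ + i₂ + i₃) (by rw [add_assoc]), Monoidal.ι_tensorHom]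
    dsimp only [categoryOfGradedObjects_id]
    rw [tensorHom_id, whisker_assoc_symm_assoc, Iso.hom_inv_id_assoc,
      ← MonoidalCategory.comp_whiskerRight_assoc, ← MonoidalCategory.comp_whiskerRight_assoc,
      ← Monoidal.ιTensorObj₃_eq X₁ X₂ X₃ i₁ i₂ i₃ _ rfl _ rfl, ι_twistAssociator_inv,
      MonoidalLinear.smul_whiskerRight, Linear.smul_comp, Linear.comp_smul, Linear.comp_smul,
      MonoidalCategory.comp_whiskerRight_assoc, MonoidalCategory.pentagon_inv_assoc]
  conv_rhs =>
    rw [Monoidal.ιTensorObj₄_eq X₁ X₂ X₃ X₄ i₁ i₂ i₃ i₄ _ _ _ rfl,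
      Monoidal.ιTensorObj₃_eq X₂ X₃ X₄ i₂ i₃ i₄ _ rfl _ rfl, Category.assoc,
      MonoidalCategory.whiskerLeft_comp_assoc,
      ← Monoidal.ιTensorObj₃_eq_assoc X₁ X₂ (Monoidal.tensorObj X₃ X₄) i₁ i₂ (i₃ + i₄) j
        (by rw [← add_assoc, h]) (i₂ + i₃ + i₄) (by rw [add_assoc]),
      ι_twistAssociator_inv_assoc, Linear.smul_comp, Linear.comp_smul, Category.assoc,
      associator_inv_naturality_right_assoc,
      Monoidal.ιTensorObj₃'_eq_assoc X₁ X₂ (Monoidal.tensorObj X₃ X₄) i₁ i₂ (i₃ + i₄) j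
        (by rw [← add_assoc, h]) _ rfl, whisker_exchange_assoc,
      ← Monoidal.ιTensorObj₃_eq_assoc (Monoidal.tensorObj X₁ X₂) X₃ X₄ (i₁ + i₂) i₃ i₄ j h _ rfl,
      ι_twistAssociator_inv, Linear.comp_smul, Linear.comp_smul,
      whiskerRight_tensor_assoc, Iso.hom_inv_id_assoc,
      Monoidal.ιTensorObj₃'_eq (Monoidal.tensorObj X₁ X₂) X₃ X₄ (i₁ + i₂) i₃ i₄ j h _ rfl,
      ← MonoidalCategory.comp_whiskerRight_assoc,
      ← Monoidal.ιTensorObj₃'_eq X₁ X₂ X₃ i₁ i₂ i₃ _ rfl _ rfl]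
  simp only [smul_smul]
  congr 1
  have hc := congrArg (fun x : kˣ => ((x⁻¹ : kˣ) : k)) (ω.cocycle i₁ i₂ i₃ i₄)
  simp only [mul_inv, Units.val_mul] at hc
  rw [← mul_assoc, hc, mul_comm]

lemma twist_pentagon (ω : Cocycle3 G k) (X₁ X₂ X₃ X₄ : GradedObject G I) :
    Monoidal.tensorHom (twistAssociator ω.toFun X₁ X₂ X₃).hom (𝟙 X₄) ≫
        (twistAssociator ω.toFun X₁ (Monoidal.tensorObj X₂ X₃) X₄).hom ≫
        Monoidal.tensorHom (𝟙 X₁) (twistAssociator ω.toFun X₂ X₃ X₄).hom =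
    (twistAssociator ω.toFun (Monoidal.tensorObj X₁ X₂) X₃ X₄).hom ≫
      (twistAssociator ω.toFun X₁ X₂ (Monoidal.tensorObj X₃ X₄)).hom := by
  rw [← cancel_epi (twistAssociator ω.toFun (Monoidal.tensorObj X₁ X₂) X₃ X₄).inv,
    ← cancel_epi (twistAssociator ω.toFun X₁ X₂ (Monoidal.tensorObj X₃ X₄)).inv,
    Iso.inv_hom_id_assoc, Iso.inv_hom_id, ← Category.assoc, ← twist_pentagon_inv]
  simp [Monoidal.tensorHom_comp_tensorHom, Monoidal.tensorHom_comp_tensorHom_assoc]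

lemma twist_triangle [DecidableEq G] (ω : Cocycle3 G k) (X Y : GradedObject G I) :
    (twistAssociator ω.toFun X Monoidal.tensorUnit Y).hom ≫
        Monoidal.tensorHom (𝟙 X) (Monoidal.leftUnitor Y).hom =
      Monoidal.tensorHom (Monoidal.rightUnitor X).hom (𝟙 Y) := by
  have h1 : twistHom ω.toFun X Monoidal.tensorUnit Y = 𝟙 _ := by
    ext j a b c h
    by_cases hb : b = 0
    · subst hb
      simp [ω.map_zero_mid]
    · have h0 : 𝟙 ((Monoidal.tensorUnit : GradedObject G I) b) = 0 :=
        (Monoidal.isInitialTensorUnitApply b hb).hom_ext _ _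
      have h2 : Monoidal.ιTensorObj₃ X Monoidal.tensorUnit Y a b c j h = 0 := by
        have : 𝟙 (X a ⊗ (Monoidal.tensorUnit : GradedObject G I) b ⊗ Y c) = 0 := by
          rw [← MonoidalCategory.whiskerLeft_id, ← MonoidalCategory.id_whiskerRight, h0]
          simp
        rw [← Category.id_comp (Monoidal.ιTensorObj₃ X Monoidal.tensorUnit Y a b c j h), this,
          zero_comp]
      simp [h2]
  rw [twistAssociator, Iso.trans_hom]
  have h3 : (twistIso ω.toFun X Monoidal.tensorUnit Y).hom = 𝟙 _ := h1
  rw [h3, Category.comp_id, Monoidal.triangle]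

end Twist

section VecTwist

open GradedObject

variable {k : Type w} [Field k] {G : Type} [AddGroup G]

/-- The category `I ⊠ Vec_G^ω`, realized as the category of `G`-graded objects of `I`: the family
`X` stands for the direct sum of the objects `X g ⊠ g`. The cocycle `ω` enters the associator
only. -/
def VecTwist (I : Type u) (_ω : Cocycle3 G k) : Type u := GradedObject G I

variable (I : Type u) [Category.{v} I] (ω : Cocycle3 G k)

instance : Category.{v} (VecTwist I ω) := inferInstanceAs (Category.{v} (GradedObject G I))

variable [Abelian I]

/-- The componentwise preadditive structure on graded objects. -/
@[reducible]
def gradedPreadditive : Preadditive (GradedObject G I) where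
  homGroup X Y := inferInstanceAs (AddCommGroup (∀ g : G, X g ⟶ Y g))
  add_comp _ _ _ _ _ _ := funext fun _ => Preadditive.add_comp _ _ _ _ _ _
  comp_add _ _ _ _ _ _ := funext fun _ => Preadditive.comp_add _ _ _ _ _ _

instance : Preadditive (VecTwist I ω) := gradedPreadditive (G := G) I

variable [Linear k I]

/-- The componentwise `k`-linear structure on graded objects. -/
@[reducible]
def gradedLinear : letI := gradedPreadditive (G := G) I; Linear k (GradedObject G I) :=
  letI := gradedPreadditive (G := G) I
  { homModule := fun X Y => inferInstanceAs (Module k (∀ g : G, X g ⟶ Y g))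
    smul_comp := fun _ _ _ _ _ _ => funext fun _ => Linear.smul_comp _ _ _ _ _ _
    comp_smul := fun _ _ _ _ _ _ => funext fun _ => Linear.comp_smul _ _ _ _ _ _ }

instance : Linear k (VecTwist I ω) := gradedLinear (G := G) I

variable [MonoidalCategory I] [MonoidalPreadditive I] [MonoidalLinear k I] [Finite G]
  [DecidableEq G]

/-- The tensor product of `I ⊠ Vec_G^ω` is the one of graded objects,
`(X ⊗ Y) g = ⨁ (a + b = g), X a ⊗ Y b`, and the associativity constraint is the one of `I`
multiplied by `ω a b c` on the summand `(X a ⊗ Y b) ⊗ Z c`. -/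
instance : MonoidalCategory (VecTwist I ω) where
  tensorObj X Y := Monoidal.tensorObj (I := G) (C := I) X Y
  tensorHom f g := Monoidal.tensorHom (I := G) (C := I) f g
  tensorHom_def f g := Monoidal.tensorHom_def (I := G) (C := I) f g
  whiskerLeft X _ _ φ := Monoidal.whiskerLeft (I := G) (C := I) X φ
  whiskerRight {_ _ φ Y} := Monoidal.whiskerRight (I := G) (C := I) φ Y
  tensorUnit := (Monoidal.tensorUnit : GradedObject G I)
  associator X₁ X₂ X₃ := twistAssociator (G := G) (I := I) ω.toFun X₁ X₂ X₃
  associator_naturality f₁ f₂ f₃ := twistAssociator_naturality (G := G) (I := I) ω.toFun f₁ f₂ f₃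
  leftUnitor X := Monoidal.leftUnitor (I := G) (C := I) X
  leftUnitor_naturality f := Monoidal.leftUnitor_naturality (I := G) (C := I) f
  rightUnitor X := Monoidal.rightUnitor (I := G) (C := I) X
  rightUnitor_naturality f := Monoidal.rightUnitor_naturality (I := G) (C := I) f
  whiskerLeft_id X Y := Monoidal.id_tensorHom_id (I := G) (C := I) X Y
  id_whiskerRight X Y := Monoidal.id_tensorHom_id (I := G) (C := I) X Y
  id_tensorHom_id X Y := Monoidal.id_tensorHom_id (I := G) (C := I) X Y
  tensorHom_comp_tensorHom f₁ f₂ g₁ g₂ :=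
    Monoidal.tensorHom_comp_tensorHom (I := G) (C := I) f₁ g₁ f₂ g₂
  pentagon X₁ X₂ X₃ X₄ := twist_pentagon (G := G) (I := I) ω X₁ X₂ X₃ X₄
  triangle X₁ X₂ := twist_triangle (G := G) (I := I) ω X₁ X₂

/-- The object `X ⊠ g` of `I ⊠ Vec_G^ω`. -/
def box (X : I) (g : G) : VecTwist I ω := (GradedObject.single g).obj X

end VecTwist

section NIsing

variable {k : Type w} [Field k] (I : Type u) [Category.{v} I] [Abelian I] [Linear k I]
  [MonoidalCategory I] [MonoidalPreadditive I] [MonoidalLinear k I]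

/-- The `N`-Ising category `I_{N, ζ}`: the fusion subcategory of `I ⊠ Vec_{ℤ/2^N}^{ω_ζ}`
generated by `Z ⊠ 1`, where `1` is the generator of `ℤ/2^N`. Equivalently, it is the twist of the
associator of the `ℤ/2^N`-graded subcategory of `I ⊠ Vec_{ℤ/2^N}` generated by `Z ⊠ 1` by the
cocycle `ω_ζ`. -/
abbrev NIsingCategory (N : ℕ) (ζ : rootsOfUnity (2 ^ N) k) (Z : I) : Type u :=
  (fusionClosure (box I (omega (2 ^ N) ζ) Z 1)).FullSubcategory

end NIsing

end NIsing

/-! The simple summands sitting in the components of a graded object control everything; the cocycle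
only alters the associator, so it does not affect which tensor products contain which simples.

In the Ising category, total dimension 4 forces `Z` to have dimension √2, with at most one
nontrivial invertible simple beside it (`IsIsingCategory.exists_dim`). Comparing dimensions then
yields a ℤ/2-grading: a simple summand of `A ⊗ B` is invertible exactly when `A` and `B` are both
invertible or both not (`IsIsingDim.isInvertible_iff`). Consequently, in the category generated by
`Z ⊠ 1`, invertible summands occur only in even degrees and non-invertible ones only in odd degrees
(`hasParity_of_fusionClosure`).

If a fusion subcategory has a non-invertible summand somewhere, it contains `Z ⊠ g` with `g` odd.
Since `Z ⊗ Z` contains the unit, it also contains `1 ⊠ 2g`, hence `Z ⊠ mg` for every odd `m`. An odd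
`g` is a unit modulo `2^N` with odd inverse, so `Z ⊠ 1` is reached and the subcategory is everything
(`isInvertible_of_ne_top`). A proper one therefore has only invertible summands, and each of its
simples is some invertible `S ⊠ g`. Two proper subcategories cannot factor the whole, because
products of invertibles never contain `Z`. -/

namespace NIsing

/-! ### Retracts and decompositions of the identity -/

section Retracts

variable {C : Type u} [Category.{v} C] [Preadditive C]

lemma nonempty_retract_of_comp_ne_zero [HasKernels C] {T X : C} [Simple T] {f : T ⟶ X} {g : X ⟶ T}
    (h : f ≫ g ≠ 0) : Nonempty (Retract T X) :=
  have := isIso_of_hom_simple h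
  ⟨⟨f, g ≫ inv (f ≫ g), by rw [← Category.assoc, IsIso.hom_inv_id]⟩⟩

/-- Inserting the decomposition of the identity between `f` and `g` writes `f ≫ g` as a sum, so some
term survives. This is how simple summands are located throughout. -/
lemma exists_comp_ne_zero_of_sum_eq_id {ι : Type*} (s : Finset ι) {A B X : C} {Y : ι → C}
    (p : ∀ i, X ⟶ Y i) (q : ∀ i, Y i ⟶ X) (h : ∑ i ∈ s, p i ≫ q i = 𝟙 X) {f : A ⟶ X}
    {g : X ⟶ B} (hfg : f ≫ g ≠ 0) : ∃ i ∈ s, (f ≫ p i) ≫ (q i ≫ g) ≠ 0 := by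
  by_contra! H
  apply hfg
  rw [← Category.id_comp g, ← h, Preadditive.sum_comp, Preadditive.comp_sum]
  exact Finset.sum_eq_zero fun i hi => by simpa using H i hi

lemma exists_retract_of_sum_eq_id [HasKernels C] {ι : Type*} (s : Finset ι) {T X : C} [Simple T]
    {Y : ι → C} (p : ∀ i, X ⟶ Y i) (q : ∀ i, Y i ⟶ X) (h : ∑ i ∈ s, p i ≫ q i = 𝟙 X)
    (r : Retract T X) : ∃ i ∈ s, Nonempty (Retract T (Y i)) := by
  obtain ⟨i, hi, h⟩ := exists_comp_ne_zero_of_sum_eq_id s p q h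
    (f := r.i) (g := r.r) (by rw [r.retract]; exact id_nonzero T)
  exact ⟨i, hi, nonempty_retract_of_comp_ne_zero h⟩

lemma not_isZero_of_retract {T X : C} [Simple T] (r : Retract T X) : ¬ IsZero X := fun h =>
  id_nonzero T (by rw [← r.retract, h.eq_of_tgt r.i 0, zero_comp])

lemma nonempty_iso_of_retract {T X : C} [Simple T] [Simple X] (r : Retract T X) :
    Nonempty (T ≅ X) := by
  have : IsSplitMono r.i := ⟨⟨r.r, r.retract⟩⟩
  have h : r.i ≠ 0 := fun h => id_nonzero T (by rw [← r.retract, h, zero_comp])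
  have := isIso_of_mono_of_nonzero h
  exact ⟨asIso r.i⟩

end Retracts

lemma exists_iso_biprod_of_retract {C : Type u} [Category.{v} C] [Abelian C] {T X : C}
    (r : Retract T X) : ∃ X' : C, Nonempty (X ≅ T ⊞ X') := by
  have : IsSplitMono r.i := ⟨⟨r.r, r.retract⟩⟩
  exact ⟨_, ⟨biprod.uniqueUpToIso _ _
    (isBilimitBinaryBiconeOfIsSplitMonoOfCokernel (cokernelIsCokernel r.i))⟩⟩

/-! ### Invertible objects -/

section Invertible

variable {C : Type u} [Category.{v} C] [MonoidalCategory C]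

lemma IsInvertible.of_iso {X Y : C} (e : X ≅ Y) (h : IsInvertible X) : IsInvertible Y := by
  obtain ⟨W, ⟨a⟩, ⟨b⟩⟩ := h
  exact ⟨W, ⟨whiskerRightIso e.symm W ≪≫ a⟩, ⟨whiskerLeftIso W e.symm ≪≫ b⟩⟩

lemma isInvertible_iff_of_iso {X Y : C} (e : X ≅ Y) : IsInvertible X ↔ IsInvertible Y :=
  ⟨.of_iso e, .of_iso e.symm⟩

lemma isInvertible_unit : IsInvertible (𝟙_ C) := ⟨𝟙_ C, ⟨λ_ _⟩, ⟨λ_ _⟩⟩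

end Invertible

/-! ### Semisimplicity in a fusion category -/

section Fusion

attribute [local instance] Abelian.hasFiniteBiproducts

variable {k : Type w} [Field k] {C : Type u} [Category.{v} C] [Abelian C] [Linear k C]
  [MonoidalCategory C] [MonoidalPreadditive C] [MonoidalLinear k C] [RigidCategory C]

namespace IsFusionCategory

lemma exists_decomposition (hC : IsFusionCategory k C) (X : C) :
    ∃ (n : ℕ) (S : Fin n → C) (p : ∀ i, X ⟶ S i) (q : ∀ i, S i ⟶ X),
      (∀ i, Simple (S i)) ∧ (∀ i, Nonempty (Retract (S i) X)) ∧ ∑ i, p i ≫ q i = 𝟙 X := by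
  obtain ⟨n, S, hS, ⟨e⟩⟩ := hC.semisimple X
  refine ⟨n, S, fun i => e.hom ≫ biproduct.π S i, fun i => biproduct.ι S i ≫ e.inv, hS,
    fun i => ⟨⟨biproduct.ι S i ≫ e.inv, e.hom ≫ biproduct.π S i, by simp⟩⟩, ?_⟩
  simp_rw [Category.assoc, ← Preadditive.comp_sum]
  simp_rw [← Category.assoc (biproduct.π S _), ← Preadditive.sum_comp, biproduct.total]
  simp

lemma exists_simple_retract (hC : IsFusionCategory k C) {X : C} (hX : ¬ IsZero X) :
    ∃ S : C, Simple S ∧ Nonempty (Retract S X) := by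
  obtain ⟨n, S, p, q, hS, hr, h⟩ := hC.exists_decomposition X
  obtain ⟨i, -, -⟩ := exists_comp_ne_zero_of_sum_eq_id _ p q h (f := 𝟙 X) (g := 𝟙 X)
    (by simpa using fun h => hX ((IsZero.iff_id_eq_zero X).2 h))
  exact ⟨S i, hS i, hr i⟩

lemma nonempty_retract_of_ne_zero (hC : IsFusionCategory k C) {T X : C} [Simple T] {f : T ⟶ X}
    (hf : f ≠ 0) : Nonempty (Retract T X) := by
  obtain ⟨n, S, p, q, hS, hr, h⟩ := hC.exists_decomposition X
  obtain ⟨i, -, hi⟩ := exists_comp_ne_zero_of_sum_eq_id _ p q h (f := f) (g := 𝟙 X) (by simpa)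
  have := hS i
  have : IsIso (f ≫ p i) := isIso_of_hom_simple fun h => hi (by rw [h, zero_comp])
  exact ⟨.trans (.ofIso (asIso (f ≫ p i))) (hr i).some⟩

lemma nonempty_retract_of_ne_zero' (hC : IsFusionCategory k C) {T X : C} [Simple T] {f : X ⟶ T}
    (hf : f ≠ 0) : Nonempty (Retract T X) := by
  obtain ⟨n, S, p, q, hS, hr, h⟩ := hC.exists_decomposition X
  obtain ⟨i, -, hi⟩ := exists_comp_ne_zero_of_sum_eq_id _ p q h (f := 𝟙 X) (g := f) (by simpa)
  have := hS i
  have : IsIso (q i ≫ f) := isIso_of_hom_simple fun h => hi (by rw [h, comp_zero])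
  exact ⟨.trans (.ofIso (asIso (q i ≫ f)).symm) (hr i).some⟩

lemma retract_tensor (hC : IsFusionCategory k C) {T X Y : C} [Simple T] (r : Retract T (X ⊗ Y)) :
    ∃ A B : C, Simple A ∧ Simple B ∧ Nonempty (Retract A X) ∧ Nonempty (Retract B Y) ∧
      Nonempty (Retract T (A ⊗ B)) := by
  obtain ⟨n, S, p, q, hS, hr, h⟩ := hC.exists_decomposition X
  obtain ⟨m, S', p', q', hS', hr', h'⟩ := hC.exists_decomposition Y
  obtain ⟨i, -, ⟨ri⟩⟩ := exists_retract_of_sum_eq_id _ (fun i => p i ▷ Y) (fun i => q i ▷ Y)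
    (by simp only [← comp_whiskerRight]
        rw [← sum_whiskerRight, h, id_whiskerRight]) r
  obtain ⟨j, -, rj⟩ := exists_retract_of_sum_eq_id _ (fun j => S i ◁ p' j) (fun j => S i ◁ q' j)
    (by simp only [← MonoidalCategory.whiskerLeft_comp]
        rw [← whiskerLeft_sum, h', MonoidalCategory.whiskerLeft_id]) ri
  exact ⟨S i, S' j, hS i, hS' j, hr i, hr' j, rj⟩

end IsFusionCategory

end Fusion

/-! ### Nondegeneracy of duality pairings -/

section Duality

variable {D : Type u} [Category.{v} D] [MonoidalCategory D] [HasZeroMorphisms D]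

/-- Up to unitors, the composite corresponds to `f` under the adjunction between `- ⊗ X` and `- ⊗
Y`. Assuming only that whiskering kills zero makes this usable both in the fusion category and in
its twisted graded version. -/
lemma whiskerRight_comp_evaluation_ne_zero (h0 : ∀ X Y Z : D, (0 : X ⟶ Y) ▷ Z = 0) {X Y W : D}
    [ExactPairing X Y] {f : W ⟶ Y} (hf : f ≠ 0) : f ▷ X ≫ ε_ X Y ≠ 0 := by
  intro h
  apply hf
  have h1 : (tensorRightHomEquiv W X Y (𝟙_ D)).symm (f ≫ (λ_ Y).inv) = 0 := by
    have : (tensorRightHomEquiv W X Y (𝟙_ D)).symm (f ≫ (λ_ Y).inv) = f ▷ X ≫ ε_ X Y := by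
      simp [tensorRightHomEquiv, unitors_inv_equal]
    rw [this, h]
  rw [Equiv.symm_apply_eq] at h1
  rw [← Iso.cancel_iso_inv_right _ _ (λ_ Y), h1]
  simp [tensorRightHomEquiv, h0]

lemma whiskerLeft_comp_evaluation_ne_zero (h0 : ∀ X Y Z : D, X ◁ (0 : Y ⟶ Z) = 0) {X Y W : D}
    [ExactPairing X Y] {f : W ⟶ X} (hf : f ≠ 0) : Y ◁ f ≫ ε_ X Y ≠ 0 := by
  intro h
  apply hf
  have h1 : (tensorLeftHomEquiv W X Y (𝟙_ D)).symm (f ≫ (ρ_ X).inv) = 0 := by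
    have : (tensorLeftHomEquiv W X Y (𝟙_ D)).symm (f ≫ (ρ_ X).inv) = Y ◁ f ≫ ε_ X Y := by
      simp [tensorLeftHomEquiv, unitors_equal]
    rw [this, h]
  rw [Equiv.symm_apply_eq] at h1
  rw [← Iso.cancel_iso_inv_right _ _ (ρ_ X), h1]
  simp [tensorLeftHomEquiv, h0]

lemma coevaluation_comp_whiskerLeft_ne_zero (h0 : ∀ X Y Z : D, X ◁ (0 : Y ⟶ Z) = 0) {X Y W : D}
    [ExactPairing X Y] {f : Y ⟶ W} (hf : f ≠ 0) : η_ X Y ≫ X ◁ f ≠ 0 := by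
  intro h
  apply hf
  have h1 : tensorLeftHomEquiv (𝟙_ D) X Y W ((ρ_ Y).hom ≫ f) = 0 := by
    have : tensorLeftHomEquiv (𝟙_ D) X Y W ((ρ_ Y).hom ≫ f) = η_ X Y ≫ X ◁ f := by
      simp [tensorLeftHomEquiv, unitors_inv_equal]
    rw [this, h]
  rw [← Equiv.eq_symm_apply] at h1
  rw [← Iso.cancel_iso_hom_left (ρ_ Y), h1]
  simp [tensorLeftHomEquiv, h0]

end Duality

/-! ### Frobenius-Perron dimension -/

namespace IsFPdim

variable {C : Type u} [Category.{v} C] [Abelian C] [MonoidalCategory C] {d : C → ℝ}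

lemma eq_zero (hd : IsFPdim d) {X : C} (hX : IsZero X) : d X = 0 := by
  have h := hd.biprod X X
  rw [← hd.iso _ _ ⟨isoBiprodZero (X := X) hX⟩] at h
  linarith

lemma nonneg (hd : IsFPdim d) (X : C) : 0 ≤ d X := by
  by_cases hX : IsZero X
  · exact (hd.eq_zero hX).ge
  · exact zero_le_one.trans (hd.one_le X hX)

/-- The complement of `T` in `X` is either zero or of dimension at least 1. This gap is what lets
dimensions decide fusion rules. -/
lemma iso_or_add_one_le (hd : IsFPdim d) {T X : C} (r : Retract T X) :
    Nonempty (T ≅ X) ∨ d T + 1 ≤ d X := by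
  obtain ⟨X', ⟨e⟩⟩ := exists_iso_biprod_of_retract r
  by_cases h : IsZero X'
  · exact .inl ⟨isoBiprodZero h ≪≫ e.symm⟩
  · right
    rw [hd.iso _ _ ⟨e⟩, hd.biprod]
    linarith [hd.one_le _ h]

lemma eq_or_add_one_le (hd : IsFPdim d) {T X : C} (r : Retract T X) :
    d X = d T ∨ d T + 1 ≤ d X :=
  (hd.iso_or_add_one_le r).imp_left fun h => (hd.iso _ _ h).symm

lemma eq_one (hd : IsFPdim d) {X : C} (hX : IsInvertible X) : d X = 1 := by
  obtain ⟨Y, h, -⟩ := hX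
  have h1 := hd.iso _ _ h
  rw [hd.tensor, hd.unit] at h1
  have hX : 1 ≤ d X := hd.one_le _ fun hX => by simp [hd.eq_zero hX] at h1
  have hY : 1 ≤ d Y := hd.one_le _ fun hY => by simp [hd.eq_zero hY] at h1
  nlinarith

/-- Pairwise non-isomorphic simples inject into the complete list, and the remaining squares are
nonnegative. -/
lemma sum_sq_le (hd : IsFPdim d) {n m : ℕ} {S : Fin n → C} (hS : IsCompleteSimples S)
    (t : Fin m → C) (ht : ∀ i, Simple (t i)) (h : ∀ i j, i < j → IsEmpty (t i ≅ t j)) :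
    ∑ i, d (t i) ^ 2 ≤ ∑ i, d (S i) ^ 2 := by
  choose f hf using fun i => hS.exists_iso (t i) (ht i)
  have hinj : Function.Injective f := by
    intro i j hij
    have e : t i ≅ t j := (hf i).some ≪≫ eqToIso (by rw [hij]) ≪≫ (hf j).some.symm
    rcases lt_trichotomy i j with hlt | heq | hlt
    · exact ((h i j hlt).false e).elim
    · exact heq
    · exact ((h j i hlt).false e.symm).elim
  calc ∑ i, d (t i) ^ 2 = ∑ i ∈ Finset.univ.map ⟨f, hinj⟩, d (S i) ^ 2 := by
        rw [Finset.sum_map]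
        exact Finset.sum_congr rfl fun i _ => by
          rw [hd.iso _ _ (hf i)]; rfl
    _ ≤ _ := Finset.sum_le_sum_of_subset_of_nonneg (Finset.subset_univ _)
        fun _ _ _ => sq_nonneg _

lemma sum_sq_ge (hd : IsFPdim d) {n m : ℕ} {S : Fin n → C} (hS : IsCompleteSimples S)
    (t : Fin m → C) (h : ∀ i, ∃ j, Nonempty (S i ≅ t j)) :
    ∑ i, d (S i) ^ 2 ≤ ∑ i, d (t i) ^ 2 := by
  choose f hf using h
  have hinj : Function.Injective f := fun i j hij => hS.eq_of_iso i j
    ⟨(hf i).some ≪≫ eqToIso (by rw [hij]) ≪≫ (hf j).some.symm⟩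
  calc ∑ i, d (S i) ^ 2 = ∑ i ∈ Finset.univ.map ⟨f, hinj⟩, d (t i) ^ 2 := by
        rw [Finset.sum_map]
        exact Finset.sum_congr rfl fun i _ => by
          rw [hd.iso _ _ (hf i)]; rfl
    _ ≤ _ := Finset.sum_le_sum_of_subset_of_nonneg (Finset.subset_univ _)
        fun _ _ _ => sq_nonneg _

end IsFPdim

/-! ### Simple duals and the multiplicity of the unit -/

section Fusion

variable {k : Type w} [Field k] {C : Type u} [Category.{v} C] [Abelian C] [Linear k C]
  [MonoidalCategory C] [MonoidalPreadditive C] [MonoidalLinear k C] [RigidCategory C]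

/-- Any simple summand of `Tᘁ` serves: evaluation and coevaluation restricted to it stay nonzero,
and a nonzero morphism to or from the simple unit splits. Simplicity of `Tᘁ` itself is not needed.
-/
lemma IsFusionCategory.exists_dual (hC : IsFusionCategory k C) (T : C) [Simple T] :
    ∃ T' : C, Simple T' ∧ Nonempty (Retract T' Tᘁ) ∧ Nonempty (Retract (𝟙_ C) (T ⊗ T')) ∧
      Nonempty (Retract (𝟙_ C) (T' ⊗ T)) := by
  have := hC.simple_unit
  have hT : ¬ IsZero (Tᘁ : C) := fun h =>
    whiskerLeft_comp_evaluation_ne_zero (D := C) (by simp) (X := T) (Y := Tᘁ) (id_nonzero T)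
      (((tensorRight T).map_isZero h).eq_of_src _ _)
  obtain ⟨T', hT', ⟨r⟩⟩ := hC.exists_simple_retract hT
  refine ⟨T', hT', ⟨r⟩, hC.nonempty_retract_of_ne_zero
    (coevaluation_comp_whiskerLeft_ne_zero (by simp) (X := T) (f := r.r) ?_),
    hC.nonempty_retract_of_ne_zero' (whiskerRight_comp_evaluation_ne_zero (by simp) (X := T)
      (f := r.i) ?_)⟩
  · exact fun h => id_nonzero T' (by rw [← r.retract, h, comp_zero])
  · exact fun h => id_nonzero T' (by rw [← r.retract, h, zero_comp])

/-- The unit object has multiplicity at most one in `Z ⊗ Z`, for a simple object `Z` contained in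
its dual. -/
lemma IsFusionCategory.isEmpty_retract_of_iso [IsAlgClosed k] (hC : IsFusionCategory k C) {Z W : C}
    [Simple Z] (s : Retract Z Zᘁ) (e : Z ⊗ Z ≅ 𝟙_ C ⊞ W) : IsEmpty (Retract (𝟙_ C) W) := by
  refine ⟨fun r => ?_⟩
  have := hC.simple_unit
  have := hC.finite_hom Z Z
  -- Embedding `Z` into its dual turns a morphism to `Z ⊗ Z` into one to `Z ⊗ Zᘁ`, that is, into an
  -- endomorphism of `Z`. By Schur's lemma these are scalars.
  let L : (𝟙_ C ⟶ Z ⊗ Z) → (Z ⟶ Z) := fun f =>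
    (λ_ Z).inv ≫ (tensorRightHomEquiv (𝟙_ C) Z (Zᘁ) Z).symm (f ≫ Z ◁ s.i)
  have hL : Function.Injective L := by
    intro f g h
    have h := (tensorRightHomEquiv (𝟙_ C) Z (Zᘁ) Z).symm.injective ((cancel_epi _).1 h)
    have hs : Z ◁ s.i ≫ Z ◁ s.r = 𝟙 _ := by
      rw [← MonoidalCategory.whiskerLeft_comp, s.retract, MonoidalCategory.whiskerLeft_id]
    simpa [hs] using congrArg (· ≫ Z ◁ s.r) h
  have hlin : ∀ (x y : k) (f g : 𝟙_ C ⟶ Z ⊗ Z), L (x • f + y • g) = x • L f + y • L g := by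
    intro x y f g
    simp [L, tensorRightHomEquiv]
  obtain ⟨x, hx⟩ := endomorphism_simple_eq_smul_id k (L (biprod.inl ≫ e.inv))
  obtain ⟨y, hy⟩ := endomorphism_simple_eq_smul_id k (L (r.i ≫ biprod.inr ≫ e.inv))
  -- Two copies of the unit have images `x` and `y` under `L`; this combination cancels them.
  -- Projecting to the second copy gives `x = 0`, so the first inclusion would vanish.
  have key : (-y) • (biprod.inl ≫ e.inv) + x • (r.i ≫ biprod.inr ≫ e.inv) = 0 := by
    apply hL
    have h0 : L 0 = 0 := by simpa using hlin 0 0 0 0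
    rw [hlin, h0, ← hx, ← hy, smul_smul, smul_smul, ← add_smul]
    simp [mul_comm]
  have hx0 : x = 0 := by
    have := congrArg (· ≫ e.hom ≫ biprod.snd ≫ r.r) key
    simpa [r.retract, id_nonzero] using this
  have h1 : L (biprod.inl ≫ e.inv) = L 0 := by
    rw [← hx, hx0, zero_smul]; simpa using (hlin 0 0 0 0).symm
  have h2 := congrArg (· ≫ e.hom ≫ biprod.fst) (hL h1)
  exact id_nonzero (𝟙_ C) (by simpa using h2)

end Fusion

/-! ### Dimensions and fusion rules of an Ising category -/

section Ising

variable {C : Type u} [Category.{v} C] [Abelian C] [MonoidalCategory C]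

/-- The dimensions of the simple objects of an Ising category, and the fact that a simple object
other than the unit is determined up to isomorphism by whether it is invertible. -/
structure IsIsingDim (d : C → ℝ) : Prop extends IsFPdim d where
  sqrt_two : ∀ T : C, Simple T → ¬ IsInvertible T → d T = √2
  iso_of_iff : ∀ T T' : C, Simple T → Simple T' → IsEmpty (𝟙_ C ≅ T) → IsEmpty (𝟙_ C ≅ T') →
    (IsInvertible T ↔ IsInvertible T') → Nonempty (T ≅ T')

/-- The `ℤ/2`-grading of the fusion rules of an Ising category. -/
lemma IsIsingDim.isInvertible_iff {d : C → ℝ} (hd : IsIsingDim d) {T A B : C} [Simple T] [Simple A]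
    [Simple B] (r : Retract T (A ⊗ B)) :
    IsInvertible T ↔ (IsInvertible A ↔ IsInvertible B) := by
  have h := hd.eq_or_add_one_le r
  rw [hd.tensor] at h
  have hd' : ∀ X : C, Simple X → (IsInvertible X ∧ d X = 1) ∨ (¬ IsInvertible X ∧ d X = √2) :=
    fun X hX => (em (IsInvertible X)).imp (fun h => ⟨h, hd.eq_one h⟩)
      (fun h => ⟨h, hd.sqrt_two X hX h⟩)
  have h1 : 1 < √2 := Real.one_lt_sqrt_two
  have h2 : √2 * √2 = 2 := Real.mul_self_sqrt (by norm_num)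
  -- The product `d A * d B` is 1, √2 or 2, and must equal `d T` or exceed it by at least 1. Every
  -- case of the wrong parity violates this.
  rcases hd' T ‹_› with ⟨hT, eT⟩ | ⟨hT, eT⟩ <;> rcases hd' A ‹_› with ⟨hA, eA⟩ | ⟨hA, eA⟩ <;>
    rcases hd' B ‹_› with ⟨hB, eB⟩ | ⟨hB, eB⟩ <;>
    simp only [hT, hA, hB, iff_true, iff_false, not_true] <;>
    rw [eT, eA, eB] at h <;> rcases h with h | h <;> nlinarith

end Ising

section Ising

variable {k : Type w} [Field k] {C : Type u} [Category.{v} C] [Abelian C] [Linear k C]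
  [MonoidalCategory C] [MonoidalPreadditive C] [MonoidalLinear k C] [RigidCategory C]

/-- For a simple dual `T'`, the products `T ⊗ T'` and `T' ⊗ T` cannot both be the unit, so one has a
further summand and `d T * d T' ≥ 2`. Total dimension 4 then forces `T'` to be isomorphic to `T`. -/
lemma IsFusionCategory.two_le_sq (hC : IsFusionCategory k C) {d : C → ℝ} (hd : IsFPdim d) {n : ℕ}
    {S : Fin n → C} (hS : IsCompleteSimples S) (hsum : ∑ i, d (S i) ^ 2 = 4) (T : C) [Simple T]
    (hT : ¬ IsInvertible T) :
    2 ≤ d T ^ 2 ∧ Nonempty (Retract T Tᘁ) ∧ Nonempty (Retract (𝟙_ C) (T ⊗ T)) := by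
  have := hC.simple_unit
  obtain ⟨T', hT', ⟨r⟩, ⟨r₁⟩, ⟨r₂⟩⟩ := hC.exists_dual T
  have h₁ := hd.iso_or_add_one_le r₁
  have h₂ := hd.iso_or_add_one_le r₂
  simp only [hd.tensor, hd.unit] at h₁ h₂
  have h2 : 2 ≤ d T * d T' := by
    rcases h₁ with ⟨⟨e₁⟩⟩ | h₁
    · rcases h₂ with ⟨⟨e₂⟩⟩ | h₂
      · exact (hT ⟨T', ⟨e₁.symm⟩, ⟨e₂.symm⟩⟩).elim
      · linarith
    · linarith
  have hT1 : IsEmpty (𝟙_ C ≅ T) := ⟨fun e => hT (isInvertible_unit.of_iso e)⟩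
  have hT1' : IsEmpty (𝟙_ C ≅ T') := ⟨fun e => hT1.false
    (nonempty_iso_of_retract (r₁.trans (.ofIso (whiskerLeftIso T e.symm ≪≫ ρ_ T)))).some⟩
  -- Otherwise `1`, `T`, `T'` contribute at least `1 + 2 * d T * d T' ≥ 5`.
  have h3 : Nonempty (T' ≅ T) := by
    by_contra h
    have h : IsEmpty (T ≅ T') := ⟨fun e => h ⟨e.symm⟩⟩
    have h := hd.sum_sq_le hS ![𝟙_ C, T, T'] (by simp [Fin.forall_fin_succ, *])
      (by simp [Fin.forall_fin_succ, hT1, hT1', h])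
    simp [Fin.sum_univ_succ, hd.unit, hsum] at h
    nlinarith [sq_nonneg (d T - d T')]
  obtain ⟨e⟩ := h3
  rw [hd.iso _ _ ⟨e⟩] at h2
  exact ⟨by rwa [sq], ⟨(Retract.ofIso e.symm).trans r⟩,
    ⟨r₁.trans (.ofIso (whiskerLeftIso T e))⟩⟩

/-- Each non-invertible simple contributes at least 2 to the total 4: two of them exceed it together
with the unit (1 + 2 + 2), and so does one with two nontrivial invertibles (1 + 1 + 1 + 2). A
nontrivial invertible leaves at most 2 for `Z`, giving √2; the remaining case, with no such
invertible, has to be excluded. -/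
theorem IsIsingCategory.exists_dim [IsAlgClosed k] (hI : IsIsingCategory k C) :
    ∃ d : C → ℝ, IsIsingDim d := by
  obtain ⟨d, hd, n, S, hS, hsum⟩ := hI.fpdim
  have hC := hI.toIsFusionCategory
  have := hC.simple_unit
  have key := hC.two_le_sq hd hS hsum
  have ne_one : ∀ T : C, ¬ IsInvertible T → IsEmpty (𝟙_ C ≅ T) := fun T hT =>
    ⟨fun e => hT (isInvertible_unit.of_iso e)⟩
  have ne : ∀ T T' : C, IsInvertible T → ¬ IsInvertible T' → IsEmpty (T ≅ T') :=
    fun T T' hT hT' => ⟨fun e => hT' (hT.of_iso e)⟩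
  have huniq : ∀ T T' : C, Simple T → Simple T' → ¬ IsInvertible T → ¬ IsInvertible T' →
      Nonempty (T ≅ T') := by
    intro T T' hs hs' hT hT'
    by_contra h
    have h := not_nonempty_iff.1 h
    have h := hd.sum_sq_le hS ![𝟙_ C, T, T'] (by simp [Fin.forall_fin_succ, *])
      (by simp [Fin.forall_fin_succ, ne_one _ hT, ne_one _ hT', h])
    simp [Fin.sum_univ_succ, hd.unit, hsum] at h
    linarith [(key T hT).1, (key T' hT').1]
  obtain ⟨Z, hZs, hZ⟩ : ∃ Z : C, Simple Z ∧ ¬ IsInvertible Z := by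
    simpa [IsPointed] using hI.not_pointed
  have huniq' : ∀ T T' : C, Simple T → Simple T' → IsInvertible T → IsInvertible T' →
      IsEmpty (𝟙_ C ≅ T) → IsEmpty (𝟙_ C ≅ T') → Nonempty (T ≅ T') := by
    intro T T' hs hs' hT hT' h1 h1'
    by_contra h
    have h := not_nonempty_iff.1 h
    have h := hd.sum_sq_le hS ![𝟙_ C, T, T', Z] (by simp [Fin.forall_fin_succ, *])
      (by simp [Fin.forall_fin_succ, ne_one _ hZ, ne _ _ hT hZ, ne _ _ hT' hZ, h1, h1', h])
    simp [Fin.sum_univ_succ, hd.unit, hsum, hd.eq_one hT, hd.eq_one hT'] at h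
    linarith [(key Z hZ).1]
  have hZ2 : d Z ^ 2 = 2 := by
    obtain ⟨h2, ⟨s⟩, ⟨r⟩⟩ := key Z hZ
    by_cases hex : ∃ T : C, Simple T ∧ IsInvertible T ∧ IsEmpty (𝟙_ C ≅ T)
    · obtain ⟨T, hTs, hT, hT1⟩ := hex
      have h := hd.sum_sq_le hS ![𝟙_ C, T, Z] (by simp [Fin.forall_fin_succ, *])
        (by simp [Fin.forall_fin_succ, ne_one _ hZ, hT1, ne _ _ hT hZ])
      simp [Fin.sum_univ_succ, hd.unit, hsum, hd.eq_one hT] at h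
      linarith
    -- If `1` and `Z` were the only simples, then `d Z ^ 2 = 3` and `Z ⊗ Z = 1 ⊞ W` with `d W = 2`.
    -- The unit does not occur in `W`, so `Z` does, and `d W` is √3 or at least √3 + 1, never 2.
    · exfalso
      have hall : ∀ T : C, Simple T → Nonempty (T ≅ 𝟙_ C) ∨ Nonempty (T ≅ Z) := by
        intro T hT
        by_cases hi : IsInvertible T
        · left
          by_contra h
          exact hex ⟨T, hT, hi, ⟨fun e => h ⟨e.symm⟩⟩⟩
        · exact .inr (huniq _ _ hT hZs hi hZ)
      have h := hd.sum_sq_le hS ![𝟙_ C, Z] (by simp [Fin.forall_fin_succ, *])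
        (by simp [Fin.forall_fin_succ, ne_one _ hZ])
      have h' := hd.sum_sq_ge hS ![𝟙_ C, Z] (by
        intro i
        simpa [Fin.exists_fin_succ] using hall (S i) (hS.simple i))
      simp [Fin.sum_univ_succ, hd.unit, hsum] at h h'
      obtain ⟨W, ⟨e⟩⟩ := exists_iso_biprod_of_retract r
      have hW := hd.iso _ _ ⟨e⟩
      rw [hd.tensor, hd.biprod, hd.unit] at hW
      obtain ⟨T, hT, ⟨rT⟩⟩ := hC.exists_simple_retract (X := W) fun h0 => by
        rw [hd.eq_zero h0] at hW
        nlinarith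
      rcases hall T hT with ⟨⟨e'⟩⟩ | h3
      · exact (hC.isEmpty_retract_of_iso s e).false ((Retract.ofIso e'.symm).trans rT)
      · have h4 := hd.eq_or_add_one_le rT
        rw [hd.iso _ _ h3] at h4
        rcases h4 with h4 | h4 <;> nlinarith [hd.nonneg Z]
  refine ⟨d, hd, fun T hT hT' => ?_, fun T T' hT hT' h1 h1' h => ?_⟩
  · rw [hd.iso _ _ (huniq T Z hT hZs hT' hZ), ← hZ2, Real.sqrt_sq (hd.nonneg Z)]
  · by_cases hi : IsInvertible T
    · exact huniq' T T' hT hT' hi (h.1 hi) h1 h1'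
    · exact huniq T T' hT hT' hi (fun h' => hi (h.2 h'))

/-- A simple object of an Ising category is self-dual. -/
lemma IsIsingDim.nonempty_retract_tensor_self {d : C → ℝ} (hd : IsIsingDim d)
    (hC : IsFusionCategory k C) (T : C) [Simple T] : Nonempty (Retract (𝟙_ C) (T ⊗ T)) := by
  have := hC.simple_unit
  obtain ⟨T', hT', -, ⟨r⟩, ⟨r'⟩⟩ := hC.exists_dual T
  suffices h : Nonempty (T' ≅ T) from ⟨r.trans (.ofIso (whiskerLeftIso T h.some))⟩
  by_cases h1 : Nonempty (𝟙_ C ≅ T)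
  · obtain ⟨e⟩ := h1
    obtain ⟨e'⟩ := nonempty_iso_of_retract (r.trans (.ofIso (whiskerRightIso e.symm T' ≪≫ λ_ T')))
    exact ⟨e'.symm ≪≫ e⟩
  by_cases h2 : Nonempty (𝟙_ C ≅ T')
  · obtain ⟨e⟩ := h2
    obtain ⟨e'⟩ := nonempty_iso_of_retract (r.trans (.ofIso (whiskerLeftIso T e.symm ≪≫ ρ_ T)))
    exact ⟨e.symm ≪≫ e'⟩
  -- The unit occurs in `T' ⊗ T`, so by the grading `T'` and `T` are both invertible or both not.
  · exact hd.iso_of_iff T' T hT' ‹_› (not_nonempty_iff.1 h2) (not_nonempty_iff.1 h1)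
      ((hd.isInvertible_iff r').1 isInvertible_unit)

/-- An invertible simple object of an Ising category is its own inverse. -/
lemma IsIsingDim.nonempty_tensor_self_iso {d : C → ℝ} (hd : IsIsingDim d)
    (hC : IsFusionCategory k C) (T : C) [Simple T] (hT : IsInvertible T) :
    Nonempty (𝟙_ C ≅ T ⊗ T) := by
  obtain ⟨r⟩ := hd.nonempty_retract_tensor_self hC T
  refine (hd.iso_or_add_one_le r).resolve_right ?_
  rw [hd.tensor, hd.unit, hd.eq_one hT]
  norm_num

end Ising

/-! ### Graded objects concentrated in one degree -/

open GradedObject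

section Graded

variable {G : Type} [AddGroup G] [Finite G] {C : Type u} [Category.{v} C] [Abelian C]
  [MonoidalCategory C]

lemma exists_ι_comp_ne_zero {X Y : GradedObject G C} {A : C} {g : G} {φ : Monoidal.tensorObj X Y g ⟶ A}
    (h : φ ≠ 0) : ∃ (a b : G) (hab : a + b = g), Monoidal.ιTensorObj X Y a b g hab ≫ φ ≠ 0 := by
  by_contra! H
  exact h (Monoidal.tensorObj_ext _ _ fun a b hab => by rw [H, comp_zero])

variable [MonoidalPreadditive C]

lemma tensorHom_zero_left (X Y : GradedObject G C) {X' Y' : GradedObject G C} (f : X' ⟶ Y') (g : G) :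
    Monoidal.tensorHom (fun i => (0 : X i ⟶ Y i)) f g = 0 := by
  ext i j h
  simp

lemma tensorHom_zero_right (X Y : GradedObject G C) {X' Y' : GradedObject G C} (f : X' ⟶ Y')
    (g : G) : Monoidal.tensorHom f (fun i => (0 : X i ⟶ Y i)) g = 0 := by
  ext i j h
  simp

end Graded

section Single

variable {G : Type} [DecidableEq G] {C : Type u} [Category.{v} C] [Abelian C]

lemma isZero_single_apply (T : C) {g i : G} (h : i ≠ g) : IsZero ((single g).obj T i) :=
  (isZero_zero C).of_iso ((isInitialSingleObjApply g T i h).uniqueUpToIso (isZero_zero C).isInitial)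

variable {T : C} {X : GradedObject G C} {g : G}

/-- The morphism from `(single g).obj T` given by its component in degree `g`. -/
def singleDesc (f : T ⟶ X g) : (single g).obj T ⟶ X := fun i =>
  if h : i = g then (singleObjApplyIsoOfEq g T i h).hom ≫ f ≫ eqToHom (by rw [h]) else 0

/-- The morphism to `(single g).obj T` given by its component in degree `g`. -/
def singleLift (f : X g ⟶ T) : X ⟶ (single g).obj T := fun i =>
  if h : i = g then eqToHom (by rw [h]) ≫ f ≫ (singleObjApplyIsoOfEq g T i h).inv else 0

@[simp]
lemma singleDesc_self (f : T ⟶ X g) : singleDesc f g = (singleObjApplyIso g T).hom ≫ f := by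
  simp [singleDesc]

@[simp]
lemma singleLift_self (f : X g ⟶ T) : singleLift f g = f ≫ (singleObjApplyIso g T).inv := by
  simp [singleLift]

/-- A retract of the component in degree `g` is a retract of the graded object. -/
def singleRetract (r : Retract T (X g)) : Retract ((single g).obj T) X where
  i := singleDesc r.i
  r := singleLift r.r
  retract := by
    funext i
    by_cases h : i = g
    · subst h
      simp
    · exact (isZero_single_apply T h).eq_of_src _ _

/-- A graded object concentrated in degree `g`. -/
def isoSingle (e : X g ≅ T) (h : ∀ i, i ≠ g → IsZero (X i)) : X ≅ (single g).obj T where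
  hom := singleLift e.hom
  inv := singleDesc e.inv
  hom_inv_id := by
    funext i
    by_cases hi : i = g
    · subst hi
      simp
    · exact (h i hi).eq_of_src _ _
  inv_hom_id := by
    funext i
    by_cases hi : i = g
    · subst hi
      simp
    · exact (isZero_single_apply T hi).eq_of_src _ _

lemma eq_zero_of_singleDesc_apply_eq_zero {f : T ⟶ X g} (h : singleDesc f g = 0) : f = 0 := by
  rw [singleDesc_self] at h
  exact (cancel_epi (singleObjApplyIso g T).hom).1 (by rw [h, comp_zero])

variable [AddGroup G] [Finite G] [MonoidalCategory C] [MonoidalPreadditive C]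

/-- The tensor product, in degree `a + b`, of two graded objects concentrated in degrees `a`
and `b`. -/
def tensorObjApplyIso {X Y : GradedObject G C} {a b : G} (hX : ∀ i, i ≠ a → IsZero (X i))
    (hY : ∀ i, i ≠ b → IsZero (Y i)) : Monoidal.tensorObj X Y (a + b) ≅ X a ⊗ Y b where
  hom := Monoidal.tensorObjDesc fun i j _ =>
    if h : i = a ∧ j = b then eqToHom (by rw [h.1, h.2]) else 0
  inv := Monoidal.ιTensorObj X Y a b _ rfl
  hom_inv_id := by
    ext i j h
    by_cases hi : i = a
    · subst hi
      obtain rfl : j = b := add_left_cancel h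
      simp
    · exact ((tensorRight _).map_isZero (hX i hi)).eq_of_src _ _
  inv_hom_id := by simp

lemma isZero_tensorObj_apply {X Y : GradedObject G C} {a b g : G} (hX : ∀ i, i ≠ a → IsZero (X i))
    (hY : ∀ i, i ≠ b → IsZero (Y i)) (hg : g ≠ a + b) : IsZero (Monoidal.tensorObj X Y g) := by
  rw [IsZero.iff_id_eq_zero]
  ext i j hij
  by_cases hi : i = a
  · have hj : j ≠ b := fun hj => hg (by rw [← hij, hi, hj])
    exact ((tensorLeft _).map_isZero (hY j hj)).eq_of_src _ _
  · exact ((tensorRight _).map_isZero (hX i hi)).eq_of_src _ _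

end Single

/-! ### The objects `T ⊠ g` in the twisted product -/

section Box

variable {k : Type w} [Field k] {G : Type} [AddGroup G] {C : Type u} [Category.{v} C]
  {ω : Cocycle3 G k}

/-- The summand in degree `g` of a retract. -/
def retractApply {X Y : VecTwist C ω} (r : Retract X Y) (g : G) : Retract (X g) (Y g) where
  i := r.i g
  r := r.r g
  retract := congrFun r.retract g

variable [Abelian C] [DecidableEq G]

/-- A retract of the component in degree `g` is a retract of the graded object. -/
def boxRetract {T : C} {X : VecTwist C ω} {g : G} (r : Retract T (X g)) : Retract (box C ω T g) X :=
  singleRetract (C := C) (X := X) r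

/-- The functoriality of `box C ω T g` in `T`. -/
def boxMapRetract {X Y : C} (r : Retract X Y) (g : G) : Retract (box C ω X g) (box C ω Y g) :=
  r.map (single g)

/-- The functoriality of `box C ω T g` in `T`. -/
def boxMapIso {X Y : C} (e : X ≅ Y) (g : G) : box C ω X g ≅ box C ω Y g :=
  (single g).mapIso e

variable [Linear k C] [MonoidalCategory C] [MonoidalPreadditive C] [MonoidalLinear k C] [Finite G]

lemma vecTwist_zero_whiskerRight (X Y Z : VecTwist C ω) : (0 : X ⟶ Y) ▷ Z = 0 :=
  funext fun g => tensorHom_zero_left (C := C) X Y (𝟙 _) g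

lemma vecTwist_whiskerLeft_zero (X Y Z : VecTwist C ω) : X ◁ (0 : Y ⟶ Z) = 0 :=
  funext fun g => tensorHom_zero_right (C := C) Y Z (𝟙 _) g

/-- `(X ⊠ a) ⊗ (Y ⊠ b) = (X ⊗ Y) ⊠ (a + b)`. -/
def boxTensorIso (X Y : C) (a b : G) :
    (box C ω X a ⊗ box C ω Y b : VecTwist C ω) ≅ box C ω (X ⊗ Y) (a + b) :=
  isoSingle (C := C) (X := Monoidal.tensorObj ((single a).obj X) ((single b).obj Y))
    (tensorObjApplyIso (fun _ => isZero_single_apply X) (fun _ => isZero_single_apply Y) ≪≫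
      (singleObjApplyIso a X ⊗ᵢ singleObjApplyIso b Y))
    fun _ => isZero_tensorObj_apply (fun _ => isZero_single_apply X) (fun _ => isZero_single_apply Y)

/-- `(𝟙_ C) ⊠ 0` is the unit object. -/
def boxUnitIso : box C ω (𝟙_ C) (0 : G) ≅ 𝟙_ (VecTwist C ω) := Iso.refl _

end Box

/-! ### Parity of graded objects -/

section Parity

variable {k : Type w} [Field k] {G : Type} [AddGroup G] {C : Type u} [Category.{v} C]
  {ω : Cocycle3 G k} [Abelian C] [MonoidalCategory C]

/-- The graded objects whose simple summands in degree `g` are invertible if `π g` holds, and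
non-invertible otherwise. -/
def HasParity (ω : Cocycle3 G k) (π : G → Prop) : ObjectProperty (VecTwist C ω) := fun X =>
  ∀ (g : G) (T : C), Simple T → Nonempty (Retract T (X g)) → (IsInvertible T ↔ π g)

variable [DecidableEq G]

lemma hasParity_box {π : G → Prop} {T : C} [Simple T] {g : G} (h : IsInvertible T ↔ π g) :
    HasParity ω π (box C ω T g) := by
  rintro i S hS ⟨r⟩
  obtain rfl : i = g := by
    by_contra hi
    exact not_isZero_of_retract r (isZero_single_apply T hi)
  obtain ⟨e⟩ := nonempty_iso_of_retract (r.trans (.ofIso (singleObjApplyIso i T)))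
  rw [isInvertible_iff_of_iso e, h]

variable [Linear k C] [MonoidalPreadditive C] [MonoidalLinear k C] [Finite G] [RigidCategory C]

lemma exists_retract_of_retract_tensor (hC : IsFusionCategory k C) {X Y : VecTwist C ω} {g : G}
    {T : C} [Simple T] (r : Retract T ((X ⊗ Y : VecTwist C ω) g)) :
    ∃ a b : G, a + b = g ∧ Nonempty (Retract T (X a ⊗ Y b)) := by
  obtain ⟨a, b, hab, h⟩ := exists_ι_comp_ne_zero (X := X) (Y := Y) (φ := r.r) fun h =>
    id_nonzero T (by rw [← r.retract, h, comp_zero])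
  exact ⟨a, b, hab, hC.nonempty_retract_of_ne_zero' h⟩

/-- A nonzero morphism from `X ⊗ Y` to the unit object pairs opposite degrees of `X` and `Y`. -/
lemma exists_retract_of_ne_zero (hC : IsFusionCategory k C) {X Y : VecTwist C ω}
    {φ : X ⊗ Y ⟶ 𝟙_ (VecTwist C ω)} (hφ : φ ≠ 0) :
    ∃ a b : G, a + b = 0 ∧ Nonempty (Retract (𝟙_ C) (X a ⊗ Y b)) := by
  have := hC.simple_unit
  obtain ⟨i, hi⟩ : ∃ i, φ i ≠ 0 := by
    by_contra! h
    exact hφ (funext h)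
  obtain rfl : i = 0 := by
    by_contra h
    exact hi ((isZero_single_apply (𝟙_ C) h).eq_of_tgt _ _)
  have h1 : φ 0 ≫ (singleObjApplyIso (0 : G) (𝟙_ C)).hom ≠ 0 := fun h => hi
    ((cancel_mono (singleObjApplyIso (0 : G) (𝟙_ C)).hom).1 (h.trans zero_comp.symm))
  obtain ⟨a, b, hab, h⟩ := exists_ι_comp_ne_zero (X := X) (Y := Y) h1
  exact ⟨a, b, hab, hC.nonempty_retract_of_ne_zero' h⟩

lemma exists_retract_of_box_tensor_ne_zero (hC : IsFusionCategory k C) {X : VecTwist C ω} {T : C}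
    {g : G} {φ : box C ω T g ⊗ X ⟶ 𝟙_ (VecTwist C ω)} (hφ : φ ≠ 0) :
    Nonempty (Retract (𝟙_ C) (T ⊗ X (-g))) := by
  have := hC.simple_unit
  obtain ⟨a, b, hab, ⟨r⟩⟩ := exists_retract_of_ne_zero hC hφ
  obtain rfl : a = g := by
    by_contra h
    exact not_isZero_of_retract r ((tensorRight _).map_isZero (isZero_single_apply T h))
  obtain rfl := eq_neg_of_add_eq_zero_right hab
  exact ⟨r.trans (.ofIso (whiskerRightIso (singleObjApplyIso a T) _))⟩

lemma exists_retract_of_tensor_box_ne_zero (hC : IsFusionCategory k C) {X : VecTwist C ω} {T : C}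
    {g : G} {φ : X ⊗ box C ω T g ⟶ 𝟙_ (VecTwist C ω)} (hφ : φ ≠ 0) :
    Nonempty (Retract (𝟙_ C) (X (-g) ⊗ T)) := by
  have := hC.simple_unit
  obtain ⟨a, b, hab, ⟨r⟩⟩ := exists_retract_of_ne_zero hC hφ
  obtain rfl : b = g := by
    by_contra h
    exact not_isZero_of_retract r ((tensorLeft _).map_isZero (isZero_single_apply T h))
  obtain rfl := eq_neg_of_add_eq_zero_left hab
  exact ⟨r.trans (.ofIso (whiskerLeftIso _ (singleObjApplyIso b T)))⟩

/-- The condition on `π` makes it the kernel of a homomorphism to ℤ/2, matching the grading of the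
Ising fusion rules; this handles tensor products. For duals, a summand `T` of `Y g` gives a nonzero
map `T ⊠ g ⟶ Y`; pairing with `X` puts the unit in `T ⊗ X (-g)`, so `T` has the parity of degree
`-g`, which is that of `g`. -/
lemma isFusionSubcategory_hasParity (hC : IsFusionCategory k C) {d : C → ℝ} (hd : IsIsingDim d)
    {π : G → Prop} (h0 : π 0) (hadd : ∀ a b, π (a + b) ↔ (π a ↔ π b)) :
    IsFusionSubcategory (HasParity (C := C) ω π) := by
  have := hC.simple_unit
  have hneg : ∀ g, π (-g) ↔ π g := fun g => by
    have := hadd g (-g)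
    simp only [add_neg_cancel, h0, true_iff] at this
    exact this.symm
  exact
  { prop_unit := hasParity_box (by simp [h0, isInvertible_unit])
    prop_tensor := by
      rintro X Y hX hY g T hT ⟨r⟩
      obtain ⟨a, b, rfl, ⟨r⟩⟩ := exists_retract_of_retract_tensor hC r
      obtain ⟨A, B, hA, hB, rA, rB, ⟨r⟩⟩ := hC.retract_tensor r
      rw [hadd, hd.isInvertible_iff r, hX a A hA rA, hY b B hB rB]
    of_retract := fun r h g T hT r' => h g T hT ⟨r'.some.trans (retractApply r g)⟩
    of_isBilimit := by
      rintro X Y b hb hX hY g T hT ⟨r⟩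
      have h : b.fst g ≫ b.inl g + b.snd g ≫ b.inr g = 𝟙 (b.pt g) := 
        congrFun (IsBilimit.binary_total hb) g
      have h' : r.i ≫ (b.fst g ≫ b.inl g + b.snd g ≫ b.inr g) ≫ r.r ≠ 0 := by
        rw [h, Category.id_comp, r.retract]
        exact id_nonzero T
      rw [Preadditive.add_comp, Preadditive.comp_add] at h'
      by_cases h1 : (r.i ≫ b.fst g) ≫ (b.inl g ≫ r.r) = 0
      · exact hY g T hT (nonempty_retract_of_comp_ne_zero (f := r.i ≫ b.snd g)
          (g := b.inr g ≫ r.r) fun h2 => h' (by simp only [Category.assoc] at *; rw [h1, h2, add_zero]))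
      · exact hX g T hT (nonempty_retract_of_comp_ne_zero h1)
    right_dual := by
      rintro X Y _ hX g T hT ⟨r⟩
      have hr : (boxRetract (ω := ω) r).i ≠ 0 := fun h => id_nonzero T (by
        rw [← r.retract, eq_zero_of_singleDesc_apply_eq_zero (f := r.i) (congrFun h g), zero_comp])
      obtain ⟨s⟩ := exists_retract_of_box_tensor_ne_zero hC
        (whiskerRight_comp_evaluation_ne_zero (X := X) vecTwist_zero_whiskerRight hr)
      obtain ⟨A, B, hA, hB, ⟨rA⟩, rB, ⟨s⟩⟩ := hC.retract_tensor s
      obtain ⟨e⟩ := nonempty_iso_of_retract rA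
      have := hd.isInvertible_iff s
      simp only [isInvertible_unit, true_iff] at this
      rw [← isInvertible_iff_of_iso e, this, hX _ B hB rB, hneg]
    left_dual := by
      rintro X Y _ hY g T hT ⟨r⟩
      have hr : (boxRetract (ω := ω) r).i ≠ 0 := fun h => id_nonzero T (by
        rw [← r.retract, eq_zero_of_singleDesc_apply_eq_zero (f := r.i) (congrFun h g), zero_comp])
      obtain ⟨s⟩ := exists_retract_of_tensor_box_ne_zero hC
        (whiskerLeft_comp_evaluation_ne_zero (Y := Y) vecTwist_whiskerLeft_zero hr)
      obtain ⟨A, B, hA, hB, rA, ⟨rB⟩, ⟨s⟩⟩ := hC.retract_tensor s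
      obtain ⟨e⟩ := nonempty_iso_of_retract rB
      have := hd.isInvertible_iff s
      simp only [isInvertible_unit, true_iff] at this
      rw [← isInvertible_iff_of_iso e, ← this, hY _ A hA rA, hneg] }

end Parity

/-! ### Odd multiples of the degree -/

section Powers

variable {k : Type w} [Field k] {G : Type} [AddGroup G] {C : Type u} [Category.{v} C]
  {ω : Cocycle3 G k} [Abelian C] [MonoidalCategory C] [DecidableEq G] [Linear k C]
  [MonoidalPreadditive C] [MonoidalLinear k C] [Finite G]

/-- The square of `T ⊠ g` contains `1 ⊠ 2g`; tensoring with it shifts the degree by `2g` and leaves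
`T` unchanged. -/
lemma prop_box_odd_nsmul {Q : ObjectProperty (VecTwist C ω)} [hQ : IsFusionSubcategory Q] {T : C}
    (r : Retract (𝟙_ C) (T ⊗ T)) {g : G} (h : Q (box C ω T g)) (n : ℕ) :
    Q (box C ω T ((2 * n + 1) • g)) := by
  have h2 : Q (box C ω (𝟙_ C) (g + g)) :=
    hQ.of_retract ((boxMapRetract r _).trans (.ofIso (boxTensorIso T T g g).symm))
      (hQ.prop_tensor _ _ h h)
  induction n with
  | zero => simpa using h
  | succ n ih =>
    have h3 := hQ.of_retract (.ofIso ((boxMapIso (λ_ T).symm _) ≪≫ (boxTensorIso _ _ _ _).symm))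
      (hQ.prop_tensor _ _ h2 ih)
    have : g + g + (2 * n + 1) • g = (2 * (n + 1) + 1) • g := by
      rw [← two_nsmul, ← add_nsmul]
      congr 1
      ring
    rwa [this] at h3

end Powers

/-! ### Fusion subcategories of a fusion subcategory -/

section Subcategory

variable {C : Type u} [Category.{v} C] [MonoidalCategory C]

/-- An exact pairing in a full monoidal subcategory. -/
abbrev exactPairingMk (Q : ObjectProperty C) [Q.IsMonoidal] {X Y : C} (e : ExactPairing X Y)
    (hX : Q X) (hY : Q Y) :
    ExactPairing (⟨X, hX⟩ : Q.FullSubcategory) (⟨Y, hY⟩ : Q.FullSubcategory) where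
  coevaluation' := Q.homMk (η_ X Y)
  evaluation' := Q.homMk (ε_ X Y)
  coevaluation_evaluation' := by
    ext
    exact e.coevaluation_evaluation'
  evaluation_coevaluation' := by
    ext
    exact e.evaluation_coevaluation'

/-- A class of objects of a full subcategory, seen in the ambient category. -/
def ambient {Q : ObjectProperty C} (P : ObjectProperty Q.FullSubcategory) : ObjectProperty C :=
  fun X => ∃ h : Q X, P ⟨X, h⟩

/-- Minimality of `fusionClosure` is tested against subcategories of the ambient category. Fullness
lets retracts, biproducts and dual pairings descend to `Q`. -/
instance isFusionSubcategory_ambient [Preadditive C] {Q : ObjectProperty C}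
    [hQ : IsFusionSubcategory Q] (P : ObjectProperty Q.FullSubcategory)
    [hP : IsFusionSubcategory P] : IsFusionSubcategory (ambient P) where
  prop_unit := ⟨_, hP.prop_unit⟩
  prop_tensor := fun _ _ ⟨_, h₁⟩ ⟨_, h₂⟩ => ⟨_, hP.prop_tensor _ _ h₁ h₂⟩
  of_retract := fun {X Y} r ⟨hY, h⟩ =>
    ⟨hQ.of_retract r hY, hP.of_retract (X := ⟨X, hQ.of_retract r hY⟩)
      ⟨Q.homMk r.i, Q.homMk r.r, by ext; exact r.retract⟩ h⟩
  of_isBilimit := fun {X Y} b hb ⟨hX, h₁⟩ ⟨hY, h₂⟩ => by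
    refine ⟨hQ.of_isBilimit b hb hX hY, ?_⟩
    let b' : BinaryBicone (⟨X, hX⟩ : Q.FullSubcategory) ⟨Y, hY⟩ :=
      { pt := ⟨b.pt, hQ.of_isBilimit b hb hX hY⟩
        fst := Q.homMk b.fst
        snd := Q.homMk b.snd
        inl := Q.homMk b.inl
        inr := Q.homMk b.inr
        inl_fst := by ext; exact b.inl_fst
        inl_snd := by ext; exact b.inl_snd
        inr_fst := by ext; exact b.inr_fst
        inr_snd := by ext; exact b.inr_snd }
    exact hP.of_isBilimit b' (isBinaryBilimitOfTotal b'
      (by ext; exact IsBilimit.binary_total hb)) h₁ h₂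
  right_dual := fun {X Y} e ⟨hX, h⟩ =>
    ⟨hQ.right_dual e hX, hP.right_dual (exactPairingMk Q e hX (hQ.right_dual e hX)) h⟩
  left_dual := fun {X Y} e ⟨hY, h⟩ =>
    ⟨hQ.left_dual e hY, hP.left_dual (exactPairingMk Q e (hQ.left_dual e hY) hY) h⟩

end Subcategory

/-! ### Arithmetic in ℤ/2^N -/

section Arithmetic

/-- Reduction modulo `2` on `ℤ/2^N`. -/
def parity {N : ℕ} (hN : 1 ≤ N) : ZMod (2 ^ N) →+* ZMod 2 :=
  ZMod.castHom (dvd_pow_self 2 (by omega)) (ZMod 2)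

lemma parity_add_eq_zero_iff {N : ℕ} (hN : 1 ≤ N) (a b : ZMod (2 ^ N)) :
    parity hN (a + b) = 0 ↔ (parity hN a = 0 ↔ parity hN b = 0) := by
  rw [map_add]
  generalize parity hN a = x
  generalize parity hN b = y
  revert x y
  decide

/-- An odd residue is a unit because the modulus is a power of 2, and its inverse is again odd. The
representative of that inverse is the multiplier. -/
lemma exists_odd_nsmul_eq_one {N : ℕ} (hN : 1 ≤ N) {g : ZMod (2 ^ N)}
    (hg : parity hN g ≠ 0) : ∃ n : ℕ, (2 * n + 1) • g = 1 := by
  have hval : ∀ x : ZMod (2 ^ N),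
      parity hN x = (x.val : ZMod 2) := by
    intro x
    conv_lhs => rw [← ZMod.natCast_zmod_val x]
    exact map_natCast _ _
  have hodd : Odd g.val := by
    rw [hval, ne_eq, ZMod.natCast_eq_zero_iff_even] at hg
    exact Nat.not_even_iff_odd.1 hg
  have hinv : g * g⁻¹ = 1 := by
    have := ZMod.coe_mul_inv_eq_one g.val (Nat.Coprime.pow_right N hodd.coprime_two_right)
    rwa [ZMod.natCast_zmod_val] at this
  have hodd' : Odd (g⁻¹).val := by
    rw [← Nat.not_even_iff_odd, ← ZMod.natCast_eq_zero_iff_even, ← hval]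
    intro h
    have := congrArg (parity hN) hinv
    rw [map_mul, h, mul_zero, map_one] at this
    exact absurd this (by decide)
  obtain ⟨n, hn⟩ := hodd'
  refine ⟨n, ?_⟩
  rw [← hn, nsmul_eq_mul, ZMod.natCast_zmod_val, mul_comm, hinv]

lemma exists_odd_nsmul_eq_neg {G : Type*} [AddGroup G] [Finite G] (g : G) :
    ∃ n : ℕ, (2 * n + 1) • g = -g := by
  -- The multiplier is twice the order minus 1: odd, and acting as -1.
  refine ⟨Nat.card G - 1, eq_neg_of_add_eq_zero_left ?_⟩
  have h : 2 * (Nat.card G - 1) + 1 + 1 = Nat.card G * 2 := by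
    have := Nat.card_pos (α := G)
    omega
  rw [← succ_nsmul, h, mul_nsmul, card_nsmul_eq_zero', nsmul_zero]

end Arithmetic

/-! ### Proper fusion subcategories of the N-Ising category -/

section NIsing

variable {k : Type w} [Field k] [IsAlgClosed k] {I : Type u} [Category.{v} I] [Abelian I]
  [Linear k I] [MonoidalCategory I] [MonoidalPreadditive I] [MonoidalLinear k I] [RigidCategory I]
  {Z : I} {N : ℕ} {ζ : rootsOfUnity (2 ^ N) k}

/-- In an object of the `N`-Ising category, the simple summands of even degree are invertible and
those of odd degree are not. -/
lemma hasParity_of_fusionClosure (hI : IsIsingCategory k I) (hZ : Simple Z)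
    (hZ' : ¬ IsInvertible Z) (hN : 1 ≤ N) {X : VecTwist I (omega (2 ^ N) ζ)}
    (hX : fusionClosure (box I (omega (2 ^ N) ζ) Z 1) X) :
    HasParity (omega (2 ^ N) ζ) (fun g => parity hN g = 0) X := by
  obtain ⟨d, hd⟩ := hI.exists_dim
  exact hX _ (isFusionSubcategory_hasParity hI.toIsFusionCategory hd (map_zero _)
    (parity_add_eq_zero_iff hN)) (hasParity_box (by simp [hZ']))

/-- The simple summands of the components of the objects of a proper fusion subcategory are
invertible. -/
lemma isInvertible_of_ne_top (hI : IsIsingCategory k I) (hZ : Simple Z) (hZ' : ¬ IsInvertible Z)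
    (hN : 1 ≤ N) {P : ObjectProperty (NIsingCategory I N ζ Z)} (hP : IsFusionSubcategory P)
    (hP' : P ≠ ⊤) {X : NIsingCategory I N ζ Z} (hX : P X) {T : I} (hT : Simple T)
    {g : ZMod (2 ^ N)} (r : Retract T (X.obj g)) : IsInvertible T := by
  by_contra h
  apply hP'
  obtain ⟨d, hd⟩ := hI.exists_dim
  have hC := hI.toIsFusionCategory
  have hg : parity hN g ≠ 0 := fun hg =>
    h ((hasParity_of_fusionClosure hI hZ hZ' hN X.property g T hT ⟨r⟩).2 hg)
  obtain ⟨n, hn⟩ := exists_odd_nsmul_eq_one hN hg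
  obtain ⟨e⟩ : Nonempty (Z ≅ T) := hd.iso_of_iff Z T hZ hT
    ⟨fun e => hZ' (isInvertible_unit.of_iso e)⟩ ⟨fun e => h (isInvertible_unit.of_iso e)⟩
    (iff_of_false hZ' h)
  have hT' : ambient P (box I (omega (2 ^ N) ζ) T g) :=
    (isFusionSubcategory_ambient P).of_retract (boxRetract r) ⟨X.property, hX⟩
  have h1 := prop_box_odd_nsmul (hd.nonempty_retract_tensor_self hC T).some hT' n
  rw [hn] at h1
  have h2 := (isFusionSubcategory_ambient P).of_retract (.ofIso (boxMapIso e 1)) h1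
  ext Y
  -- `ambient P` now contains the generator `Z ⊠ 1`, hence by minimality every object `Y`.
  obtain ⟨_, h3⟩ := Y.property _ (isFusionSubcategory_ambient P) h2
  exact ⟨fun _ => trivial, fun _ => h3⟩

/-- A simple `X` has an invertible simple summand `S` in some degree `g`, and `S ⊗ S` is the unit.
So `S ⊠ (-g)`, an odd multiple of the degree of `S ⊠ g`, lies in `P` and inverts it; the split
inclusion of `S ⊠ g` into the simple `X` is an isomorphism. -/
lemma isPointed_of_ne_top (hI : IsIsingCategory k I) (hZ : Simple Z) (hZ' : ¬ IsInvertible Z)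
    (hN : 1 ≤ N) (P : ObjectProperty (NIsingCategory I N ζ Z)) [hP : IsFusionSubcategory P]
    (hP' : P ≠ ⊤) : IsPointed P.FullSubcategory := by
  intro X hX
  obtain ⟨d, hd⟩ := hI.exists_dim
  have hC := hI.toIsFusionCategory
  obtain ⟨g, hg⟩ : ∃ g, ¬ IsZero (X.obj.obj g) := by
    by_contra! h
    apply id_nonzero X
    ext
    exact funext fun g => (h g).eq_of_src _ _
  obtain ⟨S, hS, ⟨r⟩⟩ := hC.exists_simple_retract hg
  have hS' := isInvertible_of_ne_top hI hZ hZ' hN hP hP' X.property hS r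
  obtain ⟨e⟩ := hd.nonempty_tensor_self_iso hC S hS'
  have h1 : ambient P (box I (omega (2 ^ N) ζ) S g) :=
    (isFusionSubcategory_ambient P).of_retract (boxRetract r) ⟨X.obj.property, X.property⟩
  obtain ⟨n, hn⟩ := exists_odd_nsmul_eq_neg g
  have h2 := prop_box_odd_nsmul (.ofIso e) h1 n
  rw [hn] at h2
  have hinv : ∀ a b : ZMod (2 ^ N), a + b = 0 → Nonempty (box I (omega (2 ^ N) ζ) S a ⊗
      box I (omega (2 ^ N) ζ) S b ≅ 𝟙_ (VecTwist I (omega (2 ^ N) ζ))) := by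
    intro a b hab
    exact ⟨boxTensorIso S S a b ≪≫ boxMapIso e.symm _ ≪≫ eqToIso (by rw [hab]) ≪≫ boxUnitIso⟩
  obtain ⟨h1, h1'⟩ := h1
  obtain ⟨h2, h2'⟩ := h2
  let B : P.FullSubcategory := ⟨⟨box I (omega (2 ^ N) ζ) S g, h1⟩, h1'⟩
  have hB : IsInvertible B :=
    ⟨⟨⟨box I (omega (2 ^ N) ζ) S (-g), h2⟩, h2'⟩,
      ⟨P.isoMk (ObjectProperty.isoMk _ (hinv _ _ (add_neg_cancel g)).some)⟩,
      ⟨P.isoMk (ObjectProperty.isoMk _ (hinv _ _ (neg_add_cancel g)).some)⟩⟩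
  let f : B ⟶ X := P.homMk (ObjectProperty.homMk (boxRetract r).i)
  have : IsSplitMono f := ⟨⟨P.homMk (ObjectProperty.homMk (boxRetract r).r), by
    ext; exact (boxRetract r).retract⟩⟩
  have hf : f ≠ 0 := by
    intro hf
    have h0 : (boxRetract (ω := omega (2 ^ N) ζ) r).i = 0 := congrArg (fun f => f.hom.hom) hf
    exact id_nonzero S (by
      rw [← r.retract, eq_zero_of_singleDesc_apply_eq_zero (f := r.i) (congrFun h0 g), zero_comp])
  have := isIso_of_mono_of_nonzero hf
  exact hB.of_iso (asIso f)

/-- If `Z ⊠ 1` were a summand of `X ⊗ Y`, then `Z` would occur in a product of two simple summands,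
both invertible by properness, against the grading. -/
lemma not_isExactFactorization (hI : IsIsingCategory k I) (hZ : Simple Z) (hZ' : ¬ IsInvertible Z)
    (hN : 1 ≤ N) {A B : ObjectProperty (NIsingCategory I N ζ Z)} (hA : A ≠ ⊤) (hB : B ≠ ⊤) :
    ¬ IsExactFactorization A B := by
  intro h
  obtain ⟨d, hd⟩ := hI.exists_dim
  have hC := hI.toIsFusionCategory
  obtain ⟨X, Y, hX, hY, ⟨r⟩⟩ := h.factor ⟨box I (omega (2 ^ N) ζ) Z 1, self_fusionClosure _⟩
  let r₁ : Retract (box I (omega (2 ^ N) ζ) Z 1) (X.obj ⊗ Y.obj) :=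
    r.map (ObjectProperty.ι _)
  obtain ⟨a, b, -, ⟨r₂⟩⟩ := exists_retract_of_retract_tensor hC
    ((Retract.ofIso (GradedObject.singleObjApplyIso (1 : ZMod (2 ^ N)) Z).symm).trans (retractApply r₁ 1))
  obtain ⟨S, T, hS, hT, ⟨rS⟩, ⟨rT⟩, ⟨r₃⟩⟩ := hC.retract_tensor r₂
  exact hZ' ((hd.isInvertible_iff r₃).2 (iff_of_true
    (isInvertible_of_ne_top hI hZ hZ' hN h.left hA hX hS rS)
    (isInvertible_of_ne_top hI hZ hZ' hN h.right hB hY hT rT)))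

end NIsing

end NIsing

/-- Let `I` be an Ising category over `k` with non-invertible simple object `Z`, let `N ≥ 1` and let
`ζ` be a `2^N`-th root of unity. Every proper fusion subcategory of `I_{N, ζ}` is pointed, and
`I_{N, ζ}` admits no exact factorization into two proper fusion subcategories. -/
theorem theorem4p5 {k : Type w} [Field k] [IsAlgClosed k] [CharZero k]
    {I : Type u} [Category.{v} I] [Abelian I] [Linear k I]
    [MonoidalCategory I] [MonoidalPreadditive I] [MonoidalLinear k I] [RigidCategory I]
    (hI : NIsing.IsIsingCategory k I)
    (Z : I) (hZ : Simple Z) (hZ' : ¬ NIsing.IsInvertible Z)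
    (N : ℕ) (hN : 1 ≤ N) (ζ : rootsOfUnity (2 ^ N) k) :
    (∀ (P : ObjectProperty (NIsing.NIsingCategory I N ζ Z)) [NIsing.IsFusionSubcategory P],
        P ≠ ⊤ → NIsing.IsPointed P.FullSubcategory) ∧
      ¬ ∃ A B : ObjectProperty (NIsing.NIsingCategory I N ζ Z),
        A ≠ ⊤ ∧ B ≠ ⊤ ∧ NIsing.IsExactFactorization A B := by
  exact ⟨fun P _ hP => NIsing.isPointed_of_ne_top hI hZ hZ' hN P hP,
    fun ⟨_, _, hA, hB, h⟩ => NIsing.not_isExactFactorization hI hZ hZ' hN hA hB h⟩
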